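/- Let $r\colon\mathbb R\to\mathbb R$ be a smooth function with $r>0$ on $(0,1)$, $r(0)=r(1)=0$ and $|r'(0)|,|r'(1)|<\frac1{2\pi}$. Let $\Sigma\subset\mathbb R^3$ be the surface of revolution parametrized by $$X\colon(0,1)\times\mathbb R\to\mathbb R^3,\qquad X(x,\phi)=(x,\;r(x)\cos\phi,\;r(x)\sin\phi),$$ with the metric $k=[1+r'(x)^2]\,dx^2+r(x)^2\,d\phi^2$ induced from $\mathbb R^3$, and let $(M,g)=(\mathbb R\times\Sigma,\,-dt^2+k)$, time-oriented by $\partial_t$. Let $\mathcal N_g$ be the space of null geodesics of $(M,g)$, i.e. the quotient, with the quotient topology, of the bundle of future pointing null vectors $$\{v\in TM \mid g(v,v)=0,\ v\neq 0,\ v\text{ future pointing}\}$$ by the equivalence relation that identifies two vectors if, up to multiplication by positive constants, they are velocity vectors of one and the same geodesic of $(M,g)$ (equivalently, the quotient by the geodesic flow and the flow of the Euler vector field). Then $\mathcal N_g$ is not Hausdorff. More precisely, there are a sequence $(\kappa_n)_{n\in\mathbb N}$ in $\mathcal N_g$ and two distinct elements $\kappa^1\neq\kappa^2$ of $\mathcal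 N_g$ such that $\kappa_n\to\kappa^1$ and $\kappa_n\to\kappa^2$, where each of $\kappa^1,\kappa^2$ is represented by a null geodesic whose projection to $\Sigma$ runs in a meridian $\{\phi=\mathrm{const}\}$. -/

import Mathlib

open Set Filter Topology
open scoped ContDiff

noncomputable section

namespace NullGeod

/-! ### Geodesic equation of a metric in coordinates -/

/-- The partial derivative `∂f/∂q^i` of a function of `n` real coordinates. -/
def pd {n : ℕ} {V : Type*} [NormedAddCommGroup V] [NormedSpace ℝ V]
    (i : Fin n) (f : (Fin n → ℝ) → V) (q : Fin n → ℝ) : V :=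
  fderiv ℝ f q (Pi.single i 1)

/-- The Christoffel symbol `Γ^k_{ij}` of the Levi-Civita connection of the metric with
coefficient matrix `G`. -/
def christoffel {n : ℕ} (G : (Fin n → ℝ) → Matrix (Fin n) (Fin n) ℝ) (k i j : Fin n)
    (q : Fin n → ℝ) : ℝ :=
  1 / 2 * ∑ l, (G q)⁻¹ k l *
    (pd i (fun y => G y j l) q + pd j (fun y => G y i l) q - pd l (fun y => G y i j) q)

/-- The geodesic equation `c''^k + Γ^k_{ij}(c) c'^i c'^j = 0` at the parameter `t`. -/
def GeodesicEqAt {n : ℕ} (G : (Fin n → ℝ) → Matrix (Fin n) (Fin n) ℝ)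
    (c : ℝ → Fin n → ℝ) (t : ℝ) : Prop :=
  ∀ k, deriv (deriv c) t k +
    ∑ i, ∑ j, christoffel G k i j (c t) * deriv c t i * deriv c t j = 0

/-! ### The surface of revolution and the static spacetime over it -/

/-- Euclidean three-space. -/
abbrev E3 : Type := EuclideanSpace ℝ (Fin 3)

/-- The parametrization `X(x, φ) = (x, r(x) cos φ, r(x) sin φ)`. -/
def param (r : ℝ → ℝ) (x φ : ℝ) : E3 :=
  !₂[x, r x * Real.cos φ, r x * Real.sin φ]

/-- The surface of revolution `Σ ⊆ ℝ³`. -/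
def surface (r : ℝ → ℝ) : Set E3 :=
  {p | ∃ x ∈ Ioo (0 : ℝ) 1, ∃ φ : ℝ, param r x φ = p}

/-- The meridian `φ = φ₀` of the surface. -/
def meridian (r : ℝ → ℝ) (φ₀ : ℝ) : Set E3 :=
  {p | ∃ x ∈ Ioo (0 : ℝ) 1, param r x φ₀ = p}

/-- The manifold `M = ℝ × Σ`, as a submanifold of `ℝ × ℝ³`. -/
def spacetime (r : ℝ → ℝ) : Set (ℝ × E3) := univ ×ˢ surface r

/-- The bilinear form `-dt² + ⟨·,·⟩` on `ℝ × ℝ³`. Its restriction to the tangent spaces of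
`M = ℝ × Σ` is the metric `g = -dt² + k`, where `k` is the metric induced on `Σ`. -/
def lorentz (v w : ℝ × E3) : ℝ := -(v.1 * w.1) + inner ℝ v.2 w.2

/-- The range `ℝ × (0,1) × ℝ` of the coordinates `(t, x, φ)`. -/
def coordDomain : Set (Fin 3 → ℝ) := {q | q 1 ∈ Ioo (0 : ℝ) 1}

/-- The parametrization `(t, x, φ) ↦ (t, X(x, φ))` of `M`. On `coordDomain` it is a local
diffeomorphism onto `M`; its local inverses are the coordinate charts of `M`. -/
def coords (r : ℝ → ℝ) (q : Fin 3 → ℝ) : ℝ × E3 := (q 0, param r (q 1) (q 2))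

/-- The tangent space of `M` at `p`, as a subset of `ℝ × ℝ³`. -/
def tangentSpace (r : ℝ → ℝ) (p : ℝ × E3) : Set (ℝ × E3) :=
  {v | ∃ q ∈ coordDomain, coords r q = p ∧ ∃ u, fderiv ℝ (coords r) q u = v}

/-- The coefficients `g(∂_i, ∂_j)` of `g` in the coordinates `(t, x, φ)`. -/
def metricCoeff (r : ℝ → ℝ) (q : Fin 3 → ℝ) : Matrix (Fin 3) (Fin 3) ℝ :=
  Matrix.of fun i j => lorentz (pd i (coords r) q) (pd j (coords r) q)

/-- `γ`, restricted to the open set `J`, is a geodesic of `(M, g)`: near every parameter it is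
`C²` in the coordinates `(t, x, φ)` and it solves the geodesic equation there. -/
def IsGeodesicOn (r : ℝ → ℝ) (γ : ℝ → ℝ × E3) (J : Set ℝ) : Prop :=
  ∀ t ∈ J, ∃ c : ℝ → Fin 3 → ℝ, ContDiffAt ℝ 2 c t ∧
    (∀ᶠ s in 𝓝 t, c s ∈ coordDomain ∧ γ s = coords r (c s)) ∧
    GeodesicEqAt (metricCoeff r) c t

/-! ### The space of null geodesics -/

/-- The bundle of future pointing null vectors `{v ∈ TM | g(v,v) = 0, v ≠ 0, v future pointing}`
(`∂_t` defines the time orientation), with the topology of `TM ⊆ (ℝ × ℝ³) × (ℝ × ℝ³)`.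
A point is a pair (base point, vector). -/
def FutureNullCone (r : ℝ → ℝ) : Type :=
  {v : (ℝ × E3) × (ℝ × E3) // v.1 ∈ spacetime r ∧ v.2 ∈ tangentSpace r v.1 ∧
    lorentz v.2 v.2 = 0 ∧ v.2 ≠ 0 ∧ lorentz (1, 0) v.2 < 0}

instance (r : ℝ → ℝ) : TopologicalSpace (FutureNullCone r) :=
  inferInstanceAs (TopologicalSpace (Subtype _))

/-- `v` is the velocity vector of the curve `γ` at the parameter `s`. -/
def IsVelocity {r : ℝ → ℝ} (γ : ℝ → ℝ × E3) (s : ℝ) (v : FutureNullCone r) : Prop :=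
  γ s = v.1.1 ∧ deriv γ s = v.1.2

/-- The null vectors `v` and `w` are tangent to one and the same geodesic, up to positive
scaling: they are related by the geodesic flow and the flow of the Euler vector field. -/
def SameLeaf (r : ℝ → ℝ) (v w : FutureNullCone r) : Prop :=
  ∃ (γ : ℝ → ℝ × E3) (J : Set ℝ), IsOpen J ∧ J.OrdConnected ∧ IsGeodesicOn r γ J ∧
    ∃ s ∈ J, ∃ t ∈ J, ∃ a : ℝ, 0 < a ∧
      IsVelocity γ s v ∧ γ t = w.1.1 ∧ deriv γ t = a • w.1.2

/-- The space of null geodesics `𝒩_g`: the quotient of the future null cone bundle by the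
equivalence relation of lying on the same leaf. -/
def NullGeodesicSpace (r : ℝ → ℝ) : Type := Quot (SameLeaf r)

/-- `𝒩_g` carries the quotient topology. -/
instance (r : ℝ → ℝ) : TopologicalSpace (NullGeodesicSpace r) :=
  inferInstanceAs (TopologicalSpace (Quot _))

/-- The null geodesic tangent to a future pointing null vector. -/
def toNullGeodesic {r : ℝ → ℝ} (v : FutureNullCone r) : NullGeodesicSpace r := Quot.mk _ v

/-- The null geodesic `κ` comes from a meridian: it is represented by a geodesic of `(M, g)`
whose projection to `Σ` runs in a meridian. -/
def IsOverMeridian {r : ℝ → ℝ} (κ : NullGeodesicSpace r) : Prop :=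
  ∃ (γ : ℝ → ℝ × E3) (J : Set ℝ) (φ₀ : ℝ), IsOpen J ∧ J.OrdConnected ∧ IsGeodesicOn r γ J ∧
    (∀ s ∈ J, (γ s).2 ∈ meridian r φ₀) ∧
    ∃ s ∈ J, ∃ v : FutureNullCone r, IsVelocity γ s v ∧ toNullGeodesic v = κ

/-! ### The metric in coordinates -/

theorem fderiv_coords_apply {r : ℝ → ℝ} (hr : Differentiable ℝ r) (q u : Fin 3 → ℝ) :
    fderiv ℝ (coords r) q u =
      (u 0, !₂[u 1, deriv r (q 1) * u 1 * Real.cos (q 2) - r (q 1) * Real.sin (q 2) * u 2,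
        deriv r (q 1) * u 1 * Real.sin (q 2) + r (q 1) * Real.cos (q 2) * u 2]) := by
  have p (i : Fin 3) : HasFDerivAt (fun y : Fin 3 → ℝ => y i)
      (ContinuousLinearMap.proj (R := ℝ) (φ := fun _ : Fin 3 => ℝ) i) q := hasFDerivAt_apply i q
  have h1 := (hr (q 1)).hasDerivAt.comp_hasFDerivAt q (p 1)
  have hc := (Real.hasDerivAt_cos (q 2)).comp_hasFDerivAt q (p 2)
  have hs := (Real.hasDerivAt_sin (q 2)).comp_hasFDerivAt q (p 2)
  have hd : DifferentiableAt ℝ (fun y : Fin 3 → ℝ => param r (y 1) (y 2)) q := by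
    rw [differentiableAt_euclidean]
    intro i
    fin_cases i
    · exact (p 1).differentiableAt
    · exact (h1.mul hc).differentiableAt
    · exact (h1.mul hs).differentiableAt
  have key := hd.hasFDerivAt
  have key' := key
  rw [← hasFDerivWithinAt_univ, hasFDerivWithinAt_euclidean] at key'
  simp only [hasFDerivWithinAt_univ] at key'
  have hF : HasFDerivAt (coords r) _ q := (p 0).prodMk key
  rw [hF.fderiv]
  refine Prod.ext rfl ?_
  ext i
  fin_cases i
  · exact congrArg (fun L => L u) ((key' 0).unique (p 1))
  · refine (congrArg (fun L => L u) ((key' 1).unique (h1.mul hc))).trans ?_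
    simp
    ring
  · refine (congrArg (fun L => L u) ((key' 2).unique (h1.mul hs))).trans ?_
    simp
    ring

/-- In the coordinates `(t, x, φ)` one has `g = -dt² + (1 + r'(x)²) dx² + r(x)² dφ²`. -/
theorem metricCoeff_eq {r : ℝ → ℝ} (hr : Differentiable ℝ r) (q : Fin 3 → ℝ) :
    metricCoeff r q = Matrix.diagonal ![-1, 1 + deriv r (q 1) ^ 2, r (q 1) ^ 2] := by
  have hcs := Real.sin_sq_add_cos_sq (q 2)
  ext i j
  simp only [metricCoeff, pd, fderiv_coords_apply hr, lorentz, Matrix.of_apply,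
    PiLp.inner_apply, Fin.sum_univ_three, RCLike.inner_apply, conj_trivial]
  fin_cases i <;> fin_cases j <;>
    simp [-abs_mul_abs_self] <;> ring_nf <;>
    first
      | done
      | linear_combination (deriv r (q 1)) ^ 2 * hcs
      | linear_combination (r (q 1)) ^ 2 * hcs

end NullGeod

end

/-!
Parametrized by its time coordinate, a null geodesic projects to a unit speed geodesic of `Σ`, whose
angle `θ` with the parallels satisfies Clairaut's relation `r(x) cos θ = const`. Fix the parallel
`x = a`, and choose `b` near `1` minimizing `r(y)² y` on `[a, b]`. The geodesic tangent to the
parallel `x = b` has small angular momentum `r(b)`; on it `cos² θ = r(b)² / r(x)² ≤ x / b`, hence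
`sin² θ ≥ b - x`, and `x` falls back to `a` in both time directions within a time bounded
independently of `b`. Hence, as `b → 1`, the two crossings of `x = a` stay in a compact set of null
vectors and subconverge. Along the sequence both crossings give the same null geodesic, but in the
limit the angular momentum vanishes, and the crossings give two meridians, one moving towards
`x = 1` and one away from it. These are different null geodesics, since a geodesic on a meridian
never turns back.

To have complete geodesics at hand, `r` is replaced by a globally positive profile `ρ` which agrees
with `r` near `[a, b]`.
-/

noncomputable section

namespace NullGeod

/-! ### Real analysis -/

theorem exists_first_hit {f : ℝ → ℝ} {p q a : ℝ} (hpq : p ≤ q) (hf : ContinuousOn f (Icc p q))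
    (hp : a < f p) (hq : f q ≤ a) : ∃ s ∈ Ioc p q, f s = a ∧ ∀ t ∈ Ico p s, a < f t := by
  have hclosed : IsCompact (Icc p q ∩ f ⁻¹' Iic a) :=
    isCompact_Icc.of_isClosed_subset (hf.preimage_isClosed_of_isClosed isClosed_Icc isClosed_Iic)
      inter_subset_left
  obtain ⟨s, ⟨hs, hsa⟩, hmin⟩ := hclosed.exists_isLeast ⟨q, right_mem_Icc.2 hpq, hq⟩
  have hbefore : ∀ t ∈ Ico p s, a < f t := fun t ht => by
    by_contra! hta
    exact ht.2.not_ge (hmin ⟨⟨ht.1, ht.2.le.trans hs.2⟩, hta⟩)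
  have hps : p < s := hs.1.lt_of_ne (by rintro rfl; exact hp.not_ge hsa)
  have hge : a ≤ f s := by
    have : s ∈ closure (Ico p s) := by
      rw [closure_Ico hps.ne]
      exact right_mem_Icc.2 hps.le
    exact ContinuousWithinAt.closure_le this continuousWithinAt_const
      ((hf s hs).mono fun t ht => ⟨ht.1, ht.2.le.trans hs.2⟩) fun t ht => (hbefore t ht).le
  exact ⟨s, ⟨hps, hs.2⟩, le_antisymm hsa hge, hbefore⟩

theorem pos_of_deriv_pos_of_forall_ne_zero {f : ℝ → ℝ} {f' τ : ℝ}
    (hf : ContinuousOn f (Icc 0 τ)) (h0 : f 0 = 0) (hd : HasDerivAt f f' 0) (hf' : 0 < f')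
    (hne : ∀ s ∈ Ioc 0 τ, (∀ u ∈ Ioo 0 s, 0 < f u) → f s ≠ 0) :
    ∀ t ∈ Ioc 0 τ, 0 < f t := by
  intro t ht
  have hinit : ∀ᶠ u in 𝓝[>] (0 : ℝ), 0 < f u := by
    have hslope := (hasDerivAt_iff_tendsto_slope.1 hd).mono_left (nhdsGT_le_nhdsNE 0)
    filter_upwards [hslope.eventually_const_lt hf', self_mem_nhdsWithin] with u hu hu0
    rwa [slope_def_field, h0, sub_zero, sub_zero, div_pos_iff_of_pos_right hu0] at hu
  obtain ⟨ε, hε, hpos⟩ := mem_nhdsGT_iff_exists_Ioc_subset.1 hinit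
  by_contra! hft
  have hεt : ε < t := by
    by_contra! htε
    exact hft.not_gt (hpos ⟨ht.1, htε⟩)
  obtain ⟨s, hs, hfs, hbefore⟩ := exists_first_hit hεt.le
    (hf.mono (Icc_subset_Icc (le_of_lt hε) ht.2)) (hpos ⟨hε, le_rfl⟩) hft
  refine hne s ⟨lt_trans hε hs.1, hs.2.trans ht.2⟩ (fun u hu => ?_) hfs
  exact (le_total u ε).elim (fun h => hpos ⟨hu.1, h⟩) fun h => hbefore u ⟨h, hu.2⟩

theorem le_sqrt_of_sqrt_le_deriv {w w' : ℝ → ℝ} {τ c : ℝ} (hτ : 0 ≤ τ)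
    (hw : ∀ s ∈ Icc 0 τ, HasDerivAt w (w' s) s) (h0 : w 0 = 0)
    (hpos : ∀ s ∈ Ioc 0 τ, 0 < w s) (hw' : ∀ s ∈ Ioc 0 τ, c * √(w s) ≤ w' s) :
    c * τ / 2 ≤ √(w τ) := by
  have hmono : MonotoneOn (fun s => √(w s) - c * s / 2) (Icc 0 τ) := by
    refine monotoneOn_of_hasDerivWithinAt_nonneg (convex_Icc 0 τ)
      (f' := fun s => w' s / (2 * √(w s)) - c / 2) ?_ ?_ ?_
    · exact (ContinuousOn.sqrt fun s hs => (hw s hs).continuousAt.continuousWithinAt).sub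
        (by fun_prop)
    · intro s hs
      rw [interior_Icc] at hs
      have hsqrt := (hw s (Ioo_subset_Icc_self hs)).sqrt (hpos s (Ioo_subset_Ioc_self hs)).ne'
      have hlin := ((hasDerivAt_id' s).const_mul c).div_const 2
      exact ((hsqrt.sub hlin).congr_deriv (by rw [mul_one])).hasDerivWithinAt
    · intro s hs
      rw [interior_Icc] at hs
      have hsqrt : 0 < √(w s) := Real.sqrt_pos.2 (hpos s (Ioo_subset_Ioc_self hs))
      rw [sub_nonneg, div_le_div_iff₀ two_pos (by positivity)]
      linarith [hw' s (Ioo_subset_Ioc_self hs)]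
  have := hmono (left_mem_Icc.2 hτ) (right_mem_Icc.2 hτ) hτ
  simp only [h0, Real.sqrt_zero, mul_zero, zero_div, sub_zero] at this
  linarith

theorem exists_isOpen_ordConnected_of_Icc_subset {p q : ℝ} (hpq : p ≤ q) {U : Set ℝ}
    (hU : IsOpen U) (h : Icc p q ⊆ U) :
    ∃ J, IsOpen J ∧ J.OrdConnected ∧ Icc p q ⊆ J ∧ J ⊆ U :=
  ⟨connectedComponentIn U p, hU.connectedComponentIn,
    isPreconnected_connectedComponentIn.ordConnected,
    isPreconnected_Icc.subset_connectedComponentIn (left_mem_Icc.2 hpq) h,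
    connectedComponentIn_subset U p⟩

theorem exists_abs_le_of_hasCompactSupport_sub {X : Type*} [TopologicalSpace X] {f : X → ℝ} {c : ℝ}
    (hf : Continuous f) (h : HasCompactSupport fun x => f x - c) : ∃ C, ∀ x, |f x| ≤ C := by
  obtain ⟨C, hC⟩ := h.exists_bound_of_continuous (hf.sub continuous_const)
  refine ⟨C + |c|, fun x => ?_⟩
  calc |f x| = |(f x - c) + c| := by rw [sub_add_cancel]
    _ ≤ |f x - c| + |c| := abs_add_le _ _
    _ ≤ C + |c| := add_le_add_left (hC x) _

theorem exists_contDiff_forall_pos_eventuallyEq_nhdsSet {E : Type*} [NormedAddCommGroup E]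
    [NormedSpace ℝ E] [FiniteDimensional ℝ E] {n : ℕ∞} {f : E → ℝ} (hf : ContDiff ℝ n f)
    {K U : Set E} (hK : IsCompact K) (hU : IsOpen U) (hKU : K ⊆ U) (hpos : ∀ x ∈ U, 0 < f x) :
    ∃ ρ : E → ℝ, ContDiff ℝ n ρ ∧ (∀ x, 0 < ρ x) ∧ (HasCompactSupport fun x => ρ x - 1) ∧
      ∀ᶠ x in 𝓝ˢ K, ρ x = f x := by
  have : ProperSpace E := FiniteDimensional.proper ℝ E
  obtain ⟨L, hL, hKL, hLU⟩ := exists_compact_between hK hU hKU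
  obtain ⟨χ, hχ1, hχ0, hχ⟩ := exists_contMDiffMap_one_nhds_of_subset_interior (n := n)
    (modelWithCornersSelf ℝ E) hK.isClosed hKL
  refine ⟨fun x => χ x * (f x - 1) + 1,
    (χ.contMDiff.contDiff.mul (hf.sub contDiff_const)).add contDiff_const, fun x => ?_, ?_, ?_⟩
  · by_cases hx : x ∈ L
    · have hfx := hpos x (hLU hx)
      have hpos' : 0 < χ x * f x + (1 - χ x) := by
        rcases (hχ x).2.eq_or_lt with h | h
        · simpa [h] using hfx
        · nlinarith [mul_nonneg (hχ x).1 hfx.le]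
      linear_combination hpos'
    · simp [hχ0 x hx]
  · refine HasCompactSupport.intro hL fun x hx => ?_
    simp [hχ0 x hx]
  · filter_upwards [hχ1] with x hx
    rw [hx]
    ring

/-! ### Integral curves -/

theorem exists_isIntegralCurve_of_bounded {E : Type*} [NormedAddCommGroup E] [NormedSpace ℝ E]
    [FiniteDimensional ℝ E] {F : E → E} (hF : ContDiff ℝ 1 F) {C : ℝ}
    (hC : ∀ z, ‖F z‖ ≤ C) (z₀ : E) :
    ∃ z : ℝ → E, z 0 = z₀ ∧ ∀ s, HasDerivAt z (F (z s)) s := by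
  have : CompleteSpace E := FiniteDimensional.complete ℝ E
  have : ProperSpace E := FiniteDimensional.proper ℝ E
  have hC0 : 0 ≤ C := (norm_nonneg _).trans (hC z₀)
  have hlocal : ∀ x : E, ∃ z : ℝ → E, z 0 = x ∧
      IsMIntegralCurveOn (I := modelWithCornersSelf ℝ E) z F (Ioo (-1) 1) := by
    intro x
    obtain ⟨K, hK⟩ := hF.locallyLipschitz.locallyLipschitzOn.exists_lipschitzOnWith_of_compact
      (isCompact_closedBall x C)
    have hPL : IsPicardLindelof (fun _ => F) (tmin := -1) (tmax := 1)
        ⟨0, by simp⟩ x ⟨C, hC0⟩ 0 ⟨C, hC0⟩ K :=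
      ⟨fun _ _ => hK, fun _ _ => continuousOn_const, fun _ _ z _ => hC z, by simp⟩
    obtain ⟨z, hz0, hz⟩ := hPL.exists_eq_forall_mem_Icc_hasDerivWithinAt₀
    exact ⟨z, hz0, fun s hs => ((hz s (Ioo_subset_Icc_self hs)).mono
      Ioo_subset_Icc_self).hasFDerivWithinAt.hasMFDerivWithinAt⟩
  obtain ⟨z, hz0, hz⟩ := exists_isMIntegralCurve_of_isMIntegralCurveOn
    (contMDiff_vectorSpace_iff_contDiff.2 hF) one_pos hlocal z₀
  refine ⟨z, hz0, fun s => ?_⟩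
  have hzs : HasFDerivAt z ((1 : ℝ →L[ℝ] ℝ).smulRight (F (z s))) s := (hz s).hasFDerivAt
  simpa using hzs.hasDerivAt

theorem contDiff_two_of_isIntegralCurve {E : Type*} [NormedAddCommGroup E] [NormedSpace ℝ E]
    {F : E → E} (hF : ContDiff ℝ 1 F) {z : ℝ → E} (hz : ∀ s, HasDerivAt z (F (z s)) s) :
    ContDiff ℝ 2 z := by
  have hderiv : deriv z = F ∘ z := funext fun s => (hz s).deriv
  have hdiff : Differentiable ℝ z := fun s => (hz s).differentiableAt
  have hz1 : ContDiff ℝ 1 z :=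
    contDiff_one_iff_deriv.2 ⟨hdiff, hderiv ▸ hF.continuous.comp hdiff.continuous⟩
  rw [show (2 : WithTop ℕ∞) = 1 + 1 by norm_num, contDiff_succ_iff_deriv]
  exact ⟨hdiff, by simp, hderiv ▸ hF.comp hz1⟩

/-! ### Unit speed geodesics of a surface of revolution -/

/-- The length of the coordinate vector `∂_x` of the surface of revolution with profile `r`. -/
def meridianSpeed (r : ℝ → ℝ) (x : ℝ) : ℝ := √(1 + deriv r x ^ 2)

/-- The unit speed geodesic vector field of the surface of revolution with profile `ρ`, in the
coordinates `(x, θ, φ)` of its unit tangent bundle, where `θ` is the angle of the velocity with the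
parallel, counted towards increasing `x`. -/
def geodesicField (ρ : ℝ → ℝ) (z : ℝ × ℝ × ℝ) : ℝ × ℝ × ℝ :=
  (Real.sin z.2.1 / meridianSpeed ρ z.1,
    deriv ρ z.1 * Real.cos z.2.1 / (ρ z.1 * meridianSpeed ρ z.1), Real.cos z.2.1 / ρ z.1)

/-- The curve `s ↦ (x s, φ s)` is a unit speed geodesic of the surface of revolution with profile
`ρ`, and `θ s` is the angle of its velocity with the parallel. -/
def IsUnitSpeedGeodesic (ρ x θ φ : ℝ → ℝ) : Prop :=
  ∀ s, HasDerivAt (fun s => (x s, θ s, φ s)) (geodesicField ρ (x s, θ s, φ s)) s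

section Profile

variable {ρ : ℝ → ℝ}

theorem meridianSpeed_sq (ρ : ℝ → ℝ) (x : ℝ) : meridianSpeed ρ x ^ 2 = 1 + deriv ρ x ^ 2 :=
  Real.sq_sqrt (by positivity)

theorem meridianSpeed_pos (ρ : ℝ → ℝ) (x : ℝ) : 0 < meridianSpeed ρ x :=
  Real.sqrt_pos.2 (by positivity)

theorem one_le_meridianSpeed (ρ : ℝ → ℝ) (x : ℝ) : 1 ≤ meridianSpeed ρ x :=
  Real.one_le_sqrt.2 (by linarith [sq_nonneg (deriv ρ x)])

theorem contDiff_meridianSpeed (hρ : ContDiff ℝ 2 ρ) : ContDiff ℝ 1 (meridianSpeed ρ) := by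
  have hρ' : ContDiff ℝ 1 (deriv ρ) := hρ.deriv'
  have hne (x : ℝ) : 1 + deriv ρ x ^ 2 ≠ 0 := by positivity
  exact (contDiff_const.add (hρ'.pow 2)).sqrt hne

theorem hasDerivAt_meridianSpeed (hρ : ContDiff ℝ 2 ρ) (x : ℝ) :
    HasDerivAt (meridianSpeed ρ) (deriv ρ x * deriv (deriv ρ) x / meridianSpeed ρ x) x := by
  have hρ' : ContDiff ℝ 1 (deriv ρ) := hρ.deriv'
  have hd : HasDerivAt (deriv ρ) (deriv (deriv ρ) x) x :=
    (hρ'.differentiable one_ne_zero x).hasDerivAt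
  have hne : 1 + deriv ρ x ^ 2 ≠ 0 := by positivity
  refine (((hd.pow 2).const_add 1).sqrt hne).congr_deriv ?_
  simp only [meridianSpeed, Nat.cast_ofNat, Nat.add_one_sub_one, pow_one, Pi.pow_apply]
  field_simp

theorem contDiff_geodesicField (hρ : ContDiff ℝ 2 ρ) (hpos : ∀ x, 0 < ρ x) :
    ContDiff ℝ 1 (geodesicField ρ) := by
  have hρ' : ContDiff ℝ 1 (deriv ρ) := hρ.deriv'
  have hx : ContDiff ℝ 1 (fun z : ℝ × ℝ × ℝ => z.1) := contDiff_fst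
  have hθ : ContDiff ℝ 1 (fun z : ℝ × ℝ × ℝ => z.2.1) := contDiff_fst.comp contDiff_snd
  have hσx := (contDiff_meridianSpeed hρ).comp hx
  have hρx := (hρ.of_le one_le_two).comp hx
  have hcos := Real.contDiff_cos.comp hθ
  have hσ0 (z : ℝ × ℝ × ℝ) : meridianSpeed ρ z.1 ≠ 0 := (meridianSpeed_pos ρ z.1).ne'
  have hρ0 (z : ℝ × ℝ × ℝ) : ρ z.1 ≠ 0 := (hpos z.1).ne'
  exact ((Real.contDiff_sin.comp hθ).div hσx hσ0).prodMk
    ((((hρ'.comp hx).mul hcos).div (hρx.mul hσx)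
      fun z => mul_ne_zero (hρ0 z) (hσ0 z)).prodMk (hcos.div hρx hρ0))

theorem exists_abs_inv_le (hρ : Continuous ρ) (hpos : ∀ x, 0 < ρ x)
    (hcs : HasCompactSupport fun x => ρ x - 1) : ∃ C, ∀ x, |(ρ x)⁻¹| ≤ C := by
  refine exists_abs_le_of_hasCompactSupport_sub (c := 1) (hρ.inv₀ fun x => (hpos x).ne') ?_
  have : (fun x => (ρ x)⁻¹ - 1) = fun x => (ρ x - 1) * -(ρ x)⁻¹ := by
    ext x
    have := (hpos x).ne'
    field_simp
    ring
  exact this ▸ hcs.mul_right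

theorem exists_abs_deriv_le (hρ : Continuous (deriv ρ))
    (hcs : HasCompactSupport fun x => ρ x - 1) : ∃ C, ∀ x, |deriv ρ x| ≤ C :=
  exists_abs_le_of_hasCompactSupport_sub (c := 0) hρ <| by
    have : (fun x => deriv ρ x - 0) = deriv fun x => ρ x - 1 := by
      ext x
      rw [deriv_sub_const, sub_zero]
    exact this ▸ hcs.deriv

theorem exists_norm_geodesicField_le (hρ : ContDiff ℝ 2 ρ) (hpos : ∀ x, 0 < ρ x)
    (hcs : HasCompactSupport fun x => ρ x - 1) : ∃ C, ∀ z, ‖geodesicField ρ z‖ ≤ C := by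
  obtain ⟨A, hA⟩ := exists_abs_inv_le hρ.continuous hpos hcs
  obtain ⟨B, hB⟩ := exists_abs_deriv_le (hρ.continuous_deriv one_le_two) hcs
  refine ⟨max 1 (max (B * A) A), fun z => ?_⟩
  have hA0 : 0 ≤ A := (abs_nonneg _).trans (hA z.1)
  have hB0 : 0 ≤ B := (abs_nonneg _).trans (hB z.1)
  have hsin := Real.abs_sin_le_one z.2.1
  have hcos := Real.abs_cos_le_one z.2.1
  have hσ : |(meridianSpeed ρ z.1)⁻¹| ≤ 1 := by
    rw [abs_of_pos (inv_pos.2 (meridianSpeed_pos ρ z.1))]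
    exact inv_le_one_of_one_le₀ (one_le_meridianSpeed ρ z.1)
  simp only [geodesicField, Prod.norm_mk, Real.norm_eq_abs, div_eq_mul_inv, mul_inv, abs_mul]
  refine max_le_max (mul_le_one₀ hsin (abs_nonneg _) hσ) (max_le_max ?_ ?_)
  · calc |deriv ρ z.1| * |Real.cos z.2.1| * (|(ρ z.1)⁻¹| * |(meridianSpeed ρ z.1)⁻¹|)
        ≤ B * 1 * (A * 1) := by gcongr; exacts [hB _, hA _]
      _ = B * A := by ring
  · calc |Real.cos z.2.1| * |(ρ z.1)⁻¹| ≤ 1 * A := by gcongr; exact hA _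
      _ = A := one_mul A

theorem exists_isUnitSpeedGeodesic (hρ : ContDiff ℝ 2 ρ) (hpos : ∀ x, 0 < ρ x)
    (hcs : HasCompactSupport fun x => ρ x - 1) (x₀ θ₀ φ₀ : ℝ) :
    ∃ x θ φ : ℝ → ℝ, IsUnitSpeedGeodesic ρ x θ φ ∧ x 0 = x₀ ∧ θ 0 = θ₀ ∧ φ 0 = φ₀ := by
  obtain ⟨C, hC⟩ := exists_norm_geodesicField_le hρ hpos hcs
  obtain ⟨z, hz0, hz⟩ :=
    exists_isIntegralCurve_of_bounded (contDiff_geodesicField hρ hpos) hC (x₀, θ₀, φ₀)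
  exact ⟨fun s => (z s).1, fun s => (z s).2.1, fun s => (z s).2.2, hz,
    congrArg (·.1) hz0, congrArg (·.2.1) hz0, congrArg (·.2.2) hz0⟩

end Profile

namespace IsUnitSpeedGeodesic

variable {ρ x θ φ : ℝ → ℝ}

theorem hasDerivAt_axial (h : IsUnitSpeedGeodesic ρ x θ φ) (s : ℝ) :
    HasDerivAt x (Real.sin (θ s) / meridianSpeed ρ (x s)) s := (h s).fst

theorem hasDerivAt_angle (h : IsUnitSpeedGeodesic ρ x θ φ) (s : ℝ) :
    HasDerivAt θ (deriv ρ (x s) * Real.cos (θ s) / (ρ (x s) * meridianSpeed ρ (x s))) s :=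
  (h s).snd.fst

theorem hasDerivAt_longitude (h : IsUnitSpeedGeodesic ρ x θ φ) (s : ℝ) :
    HasDerivAt φ (Real.cos (θ s) / ρ (x s)) s := (h s).snd.snd

theorem continuous_axial (h : IsUnitSpeedGeodesic ρ x θ φ) : Continuous x :=
  continuous_iff_continuousAt.2 fun s => (h.hasDerivAt_axial s).continuousAt

theorem continuous_angle (h : IsUnitSpeedGeodesic ρ x θ φ) : Continuous θ :=
  continuous_iff_continuousAt.2 fun s => (h.hasDerivAt_angle s).continuousAt

theorem contDiff (h : IsUnitSpeedGeodesic ρ x θ φ) (hρ : ContDiff ℝ 2 ρ) (hpos : ∀ x, 0 < ρ x) :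
    ContDiff ℝ 2 fun s => (x s, θ s, φ s) :=
  contDiff_two_of_isIntegralCurve (contDiff_geodesicField hρ hpos) h

theorem clairaut (h : IsUnitSpeedGeodesic ρ x θ φ) (hρ : Differentiable ℝ ρ)
    (hpos : ∀ x, 0 < ρ x) (s t : ℝ) :
    ρ (x s) * Real.cos (θ s) = ρ (x t) * Real.cos (θ t) := by
  have hd (u : ℝ) : HasDerivAt (fun u => ρ (x u) * Real.cos (θ u)) 0 u := by
    refine (((hρ (x u)).hasDerivAt.comp u (h.hasDerivAt_axial u)).mul
      (h.hasDerivAt_angle u).cos).congr_deriv ?_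
    have := (hpos (x u)).ne'
    have := (meridianSpeed_pos ρ (x u)).ne'
    simp only [Function.comp_apply]
    field_simp
    ring
  exact is_const_of_deriv_eq_zero (fun u => (hd u).differentiableAt) (fun u => (hd u).deriv) s t

theorem reverse (h : IsUnitSpeedGeodesic ρ x θ φ) :
    IsUnitSpeedGeodesic ρ (fun s => x (-s)) (fun s => -θ (-s)) (fun s => -φ (-s)) := by
  intro s
  have hx := (h.hasDerivAt_axial (-s)).scomp s (hasDerivAt_neg s)
  have hθ := ((h.hasDerivAt_angle (-s)).scomp s (hasDerivAt_neg s)).neg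
  have hφ := ((h.hasDerivAt_longitude (-s)).scomp s (hasDerivAt_neg s)).neg
  refine (hx.prodMk (hθ.prodMk hφ)).congr_deriv ?_
  simp [geodesicField, neg_div]

end IsUnitSpeedGeodesic

/-! ### Geodesics bouncing off a parallel -/

theorem deriv_neg_of_isMinOn_sq_mul {ρ : ℝ → ℝ} {a b : ℝ} (hρ : DifferentiableAt ℝ ρ b)
    (hρb : 0 < ρ b) (hb : 0 < b) (hab : a < b)
    (hmin : IsMinOn (fun y => ρ y ^ 2 * y) (Icc a b) b) : deriv ρ b < 0 := by
  have hd : HasDerivAt (fun y => ρ y ^ 2 * y) (2 * ρ b * deriv ρ b * b + ρ b ^ 2) b :=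
    ((hρ.hasDerivAt.pow 2).mul (hasDerivAt_id' b)).congr_deriv (by simp)
  have hnonneg := hmin.localize.hasFDerivWithinAt_nonneg hd.hasFDerivAt.hasFDerivWithinAt
    (sub_mem_posTangentConeAt_of_segment_subset (y := a)
      (by rw [segment_symm, segment_eq_Icc hab.le]))
  have hd_nonpos : 2 * ρ b * deriv ρ b * b + ρ b ^ 2 ≤ 0 :=
    nonpos_of_mul_nonneg_right hnonneg (sub_neg.2 hab)
  by_contra! hderiv
  have : 0 ≤ 2 * ρ b * deriv ρ b * b := by positivity
  linarith [pow_pos hρb 2]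

namespace IsUnitSpeedGeodesic

variable {ρ x θ φ : ℝ → ℝ} {a b τ : ℝ}

theorem sub_axial_le_sin_sq (h : IsUnitSpeedGeodesic ρ x θ φ) (hρ : Differentiable ℝ ρ)
    (hpos : ∀ x, 0 < ρ x) (hb : b ≤ 1) (hx0 : x 0 = b) (hθ0 : θ 0 = 0)
    (hmin : IsMinOn (fun y => ρ y ^ 2 * y) (Icc a b) b) {s : ℝ} (hs : x s ∈ Icc a b) :
    b - x s ≤ Real.sin (θ s) ^ 2 := by
  have hclairaut : ρ (x s) * Real.cos (θ s) = ρ b := by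
    rw [h.clairaut hρ hpos s 0, hx0, hθ0, Real.cos_zero, mul_one]
  have hmin_s : ρ b ^ 2 * b ≤ ρ (x s) ^ 2 * x s := hmin hs
  have hcos : Real.cos (θ s) ^ 2 * b ≤ x s := by
    refine le_of_mul_le_mul_left ?_ (pow_pos (hpos (x s)) 2)
    calc ρ (x s) ^ 2 * (Real.cos (θ s) ^ 2 * b) = ρ b ^ 2 * b := by rw [← hclairaut]; ring
      _ ≤ ρ (x s) ^ 2 * x s := hmin_s
  calc b - x s ≤ b - Real.cos (θ s) ^ 2 * b := by linarith
    _ = Real.sin (θ s) ^ 2 * b := by rw [Real.sin_sq]; ring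
    _ ≤ Real.sin (θ s) ^ 2 := mul_le_of_le_one_right (sq_nonneg _) hb

theorem strictAntiOn_axial (h : IsUnitSpeedGeodesic ρ x θ φ)
    (hsin : ∀ s ∈ Ioo 0 τ, Real.sin (θ s) < 0) : StrictAntiOn x (Icc 0 τ) := by
  refine strictAntiOn_of_deriv_neg (convex_Icc 0 τ) h.continuous_axial.continuousOn fun s hs => ?_
  rw [interior_Icc] at hs
  rw [(h.hasDerivAt_axial s).deriv]
  exact div_neg_of_neg_of_pos (hsin s hs) (meridianSpeed_pos ρ (x s))

theorem axial_lt (h : IsUnitSpeedGeodesic ρ x θ φ) (hτ : 0 < τ)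
    (hsin : ∀ s ∈ Ioo 0 τ, Real.sin (θ s) < 0) : x τ < x 0 :=
  h.strictAntiOn_axial hsin (left_mem_Icc.2 hτ.le) (right_mem_Icc.2 hτ.le) hτ

theorem sin_angle_neg (h : IsUnitSpeedGeodesic ρ x θ φ) (hρ : Differentiable ℝ ρ)
    (hpos : ∀ x, 0 < ρ x) (hb0 : 0 < b) (hb : b ≤ 1) (hab : a < b) (hx0 : x 0 = b) (hθ0 : θ 0 = 0)
    (hmin : IsMinOn (fun y => ρ y ^ 2 * y) (Icc a b) b) (hax : ∀ s ∈ Icc 0 τ, a ≤ x s) :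
    ∀ s ∈ Ioc 0 τ, Real.sin (θ s) < 0 := by
  suffices ∀ s ∈ Ioc 0 τ, 0 < -Real.sin (θ s) from fun s hs => neg_pos.1 (this s hs)
  refine pos_of_deriv_pos_of_forall_ne_zero
    (Real.continuous_sin.comp h.continuous_angle).neg.continuousOn (by simp [hθ0])
    (h.hasDerivAt_angle 0).sin.neg ?_ fun s hs hneg hzero => ?_
  · have hderiv := deriv_neg_of_isMinOn_sq_mul (hρ b) (hpos b) hb0 hab hmin
    rw [hx0, hθ0, Real.cos_zero, one_mul, mul_one, ← neg_div]
    exact div_pos (neg_pos.2 hderiv) (mul_pos (hpos b) (meridianSpeed_pos ρ b))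
  · have hlt : x s < b := hx0 ▸ h.axial_lt hs.1 fun u hu => neg_pos.1 (hneg u hu)
    have hsq := h.sub_axial_le_sin_sq hρ hpos hb hx0 hθ0 hmin ⟨hax s ⟨hs.1.le, hs.2⟩, hlt.le⟩
    rw [neg_eq_zero.1 hzero] at hsq
    linarith

theorem div_le_sqrt_sub_axial (h : IsUnitSpeedGeodesic ρ x θ φ) (hρ : Differentiable ℝ ρ)
    (hpos : ∀ x, 0 < ρ x) (hb0 : 0 < b) (hb : b ≤ 1) (hab : a < b) (hx0 : x 0 = b) (hθ0 : θ 0 = 0)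
    (hmin : IsMinOn (fun y => ρ y ^ 2 * y) (Icc a b) b) {K : ℝ}
    (hK : ∀ y ∈ Icc a b, meridianSpeed ρ y ≤ K) (hτ : 0 ≤ τ) (hax : ∀ s ∈ Icc 0 τ, a ≤ x s) :
    K⁻¹ * τ / 2 ≤ √(b - x τ) := by
  have hsin := h.sin_angle_neg hρ hpos hb0 hb hab hx0 hθ0 hmin hax
  have hlt : ∀ s ∈ Ioc 0 τ, x s < b := fun s hs =>
    hx0 ▸ h.axial_lt hs.1 fun u hu => hsin u ⟨hu.1, hu.2.le.trans hs.2⟩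
  refine le_sqrt_of_sqrt_le_deriv hτ (fun s _ => (h.hasDerivAt_axial s).const_sub b)
    (sub_eq_zero.2 hx0.symm) (fun s hs => sub_pos.2 (hlt s hs)) fun s hs => ?_
  have hmem : x s ∈ Icc a b := ⟨hax s ⟨hs.1.le, hs.2⟩, (hlt s hs).le⟩
  have hsqrt : √(b - x s) ≤ -Real.sin (θ s) := by
    rw [Real.sqrt_le_left (neg_pos.2 (hsin s hs)).le, neg_sq]
    exact h.sub_axial_le_sin_sq hρ hpos hb hx0 hθ0 hmin hmem
  have hσ := meridianSpeed_pos ρ (x s)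
  calc K⁻¹ * √(b - x s) ≤ (meridianSpeed ρ (x s))⁻¹ * -Real.sin (θ s) := by
        gcongr
        exact hK _ hmem
    _ = -(Real.sin (θ s) / meridianSpeed ρ (x s)) := by ring

theorem exists_reach (h : IsUnitSpeedGeodesic ρ x θ φ) (hρ : Differentiable ℝ ρ)
    (hpos : ∀ x, 0 < ρ x) (ha : 0 ≤ a) (hb : b ≤ 1) (hab : a < b) (hx0 : x 0 = b) (hθ0 : θ 0 = 0)
    (hmin : IsMinOn (fun y => ρ y ^ 2 * y) (Icc a b) b) {K : ℝ}
    (hK : ∀ y ∈ Icc a b, meridianSpeed ρ y ≤ K) :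
    ∃ s ∈ Ioc 0 (2 * K), x s = a ∧ Real.sin (θ s) < 0 ∧ ∀ t ∈ Icc 0 s, x t ∈ Icc a b := by
  have hb0 : 0 < b := ha.trans_lt hab
  have hK0 : 0 < K := (meridianSpeed_pos ρ b).trans_le (hK b (right_mem_Icc.2 hab.le))
  obtain ⟨t, ht, hta⟩ : ∃ t ∈ Icc 0 (2 * K), x t ≤ a := by
    by_contra! hne
    have htime := h.div_le_sqrt_sub_axial hρ hpos hb0 hb hab hx0 hθ0 hmin hK (by positivity)
      fun t ht => (hne t ht).le
    rw [show K⁻¹ * (2 * K) / 2 = 1 by field_simp, Real.one_le_sqrt] at htime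
    linarith [hne (2 * K) ⟨by positivity, le_rfl⟩]
  obtain ⟨s, hs, hxs, hbefore⟩ :=
    exists_first_hit ht.1 h.continuous_axial.continuousOn (hx0 ▸ hab) hta
  have hax : ∀ u ∈ Icc 0 s, a ≤ x u := fun u hu =>
    hu.2.lt_or_eq.elim (fun hus => (hbefore u ⟨hu.1, hus⟩).le) fun hus => hus ▸ hxs.ge
  have hsin := h.sin_angle_neg hρ hpos hb0 hb hab hx0 hθ0 hmin hax
  have hanti := h.strictAntiOn_axial fun u hu => hsin u (Ioo_subset_Ioc_self hu)
  refine ⟨s, ⟨hs.1, hs.2.trans ht.2⟩, hxs, hsin s ⟨hs.1, le_rfl⟩, fun u hu => ⟨hax u hu, ?_⟩⟩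
  exact hx0 ▸ hanti.antitoneOn (left_mem_Icc.2 hs.1.le) hu hu.1

theorem exists_bounce (h : IsUnitSpeedGeodesic ρ x θ φ) (hρ : Differentiable ℝ ρ)
    (hpos : ∀ x, 0 < ρ x) (ha : 0 ≤ a) (hb : b ≤ 1) (hab : a < b) (hx0 : x 0 = b) (hθ0 : θ 0 = 0)
    (hmin : IsMinOn (fun y => ρ y ^ 2 * y) (Icc a b) b) {K : ℝ}
    (hK : ∀ y ∈ Icc a b, meridianSpeed ρ y ≤ K) :
    ∃ s ∈ Icc (-(2 * K)) 0, ∃ t ∈ Icc 0 (2 * K), x s = a ∧ 0 < Real.sin (θ s) ∧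
      x t = a ∧ Real.sin (θ t) < 0 ∧ ∀ u ∈ Icc s t, x u ∈ Icc a b := by
  obtain ⟨t, ht, hxt, hθt, hxI⟩ := h.exists_reach hρ hpos ha hb hab hx0 hθ0 hmin hK
  obtain ⟨s, hs, hxs, hθs, hxI'⟩ :=
    h.reverse.exists_reach hρ hpos ha hb hab (by simpa using hx0) (by simpa using hθ0) hmin hK
  rw [Real.sin_neg, neg_lt_zero] at hθs
  refine ⟨-s, ⟨neg_le_neg hs.2, neg_nonpos.2 hs.1.le⟩, t, ⟨ht.1.le, ht.2⟩, hxs, hθs, hxt, hθt,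
    fun u hu => ?_⟩
  rcases le_total 0 u with hu0 | hu0
  · exact hxI u ⟨hu0, hu.2⟩
  · simpa only [neg_neg] using hxI' (-u) ⟨neg_nonneg.2 hu0, neg_le.1 hu.1⟩

end IsUnitSpeedGeodesic

/-! ### Null geodesics over unit speed geodesics -/

section GeodesicEquation

variable {r : ℝ → ℝ}

theorem pd_comp_coord {n : ℕ} {f : ℝ → ℝ} {f' : ℝ} {q : Fin n → ℝ} (i j : Fin n)
    (hf : HasDerivAt f f' (q j)) : pd i (fun y => f (y j)) q = if i = j then f' else 0 := by
  have h : HasFDerivAt (fun y : Fin n → ℝ => f (y j)) _ q :=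
    hf.comp_hasFDerivAt q (hasFDerivAt_apply (𝕜 := ℝ) j q)
  rw [pd, h.fderiv]
  by_cases hij : i = j
  · subst hij
    simp
  · simp [hij]

theorem pd_metricCoeff (hr : ContDiff ℝ 2 r) (q : Fin 3 → ℝ) (k i j : Fin 3) :
    pd k (fun y => metricCoeff r y i j) q = if k = 1 then Matrix.diagonal
      ![0, 2 * deriv r (q 1) * deriv (deriv r) (q 1), 2 * r (q 1) * deriv r (q 1)] i j else 0 := by
  have hr' : ContDiff ℝ 1 (deriv r) := hr.deriv'
  have hd : Differentiable ℝ r := hr.differentiable two_ne_zero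
  have hr1 := (hd (q 1)).hasDerivAt
  have hr2 := (hr'.differentiable one_ne_zero (q 1)).hasDerivAt
  simp only [metricCoeff_eq hd]
  by_cases hij : i = j
  · subst hij
    simp only [Matrix.diagonal_apply_eq]
    fin_cases i
    · simpa using pd_comp_coord k 1 (hasDerivAt_const (q 1) (-1 : ℝ))
    · exact pd_comp_coord k 1 (((hr2.pow 2).const_add 1).congr_deriv (by simp))
    · exact pd_comp_coord k 1 ((hr1.pow 2).congr_deriv (by simp))
  · simpa only [Matrix.diagonal_apply_ne _ hij, ite_self] using
      pd_comp_coord k 1 (hasDerivAt_const (q 1) (0 : ℝ))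

theorem inv_metricCoeff (hr : Differentiable ℝ r) {q : Fin 3 → ℝ} (hq : r (q 1) ≠ 0) :
    (metricCoeff r q)⁻¹ =
      Matrix.diagonal ![-1, (1 + deriv r (q 1) ^ 2)⁻¹, (r (q 1) ^ 2)⁻¹] := by
  have h1 : 1 + deriv r (q 1) ^ 2 ≠ 0 := by positivity
  rw [metricCoeff_eq hr]
  apply Matrix.inv_eq_right_inv
  rw [Matrix.diagonal_mul_diagonal, ← Matrix.diagonal_one]
  congr 1
  ext i
  fin_cases i
  · simp
  · exact mul_inv_cancel₀ h1
  · exact mul_inv_cancel₀ (pow_ne_zero 2 hq)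

theorem geodesicEqAt_iff (hr : ContDiff ℝ 2 r) {c : ℝ → Fin 3 → ℝ} {t : ℝ}
    (hc : r (c t 1) ≠ 0) :
    GeodesicEqAt (metricCoeff r) c t ↔
      deriv (deriv c) t 0 = 0 ∧
      deriv (deriv c) t 1 + (1 + deriv r (c t 1) ^ 2)⁻¹ *
        (deriv r (c t 1) * deriv (deriv r) (c t 1) * deriv c t 1 ^ 2
          - r (c t 1) * deriv r (c t 1) * deriv c t 2 ^ 2) = 0 ∧
      deriv (deriv c) t 2 + 2 * (deriv r (c t 1) / r (c t 1)) * deriv c t 1 * deriv c t 2 = 0 := by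
  simp only [GeodesicEqAt, christoffel, inv_metricCoeff (hr.differentiable two_ne_zero) hc,
    pd_metricCoeff hr, Fin.forall_fin_succ, Fin.sum_univ_three, Matrix.diagonal_apply, Fin.isValue]
  simp only [Fin.isValue, one_div, ↓reduceIte, Nat.succ_eq_add_one, Nat.reduceAdd,
    Matrix.cons_val_zero, zero_ne_one, add_zero, sub_self, mul_zero, Fin.reduceEq, zero_mul,
    one_ne_zero, Matrix.cons_val_one, add_sub_cancel_right, Matrix.cons_val, sub_zero, zero_add,
    zero_sub, mul_neg, neg_zero, Fin.succ_zero_eq_one, neg_mul, Fin.succ_one_eq_two,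
    Fin.succ_ne_zero, Matrix.cons_val_succ, Matrix.cons_val_fin_one, ite_mul, mul_ite,
    IsEmpty.forall_iff, and_true, and_congr_right_iff]
  refine fun _ => and_congr ?_ ?_
  · constructor <;> intro h <;> rw [← h] <;> ring
  · constructor <;> intro h <;> rw [← h] <;> field_simp <;> ring

theorem differentiable_coords (hr : Differentiable ℝ r) : Differentiable ℝ (coords r) := by
  refine Differentiable.prodMk (by fun_prop) (differentiable_euclidean.2 fun i => ?_)
  fin_cases i
  · exact differentiable_apply 1
  · exact (hr.comp (differentiable_apply 1)).mul
      (Real.differentiable_cos.comp (differentiable_apply 2))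
  · exact (hr.comp (differentiable_apply 1)).mul
      (Real.differentiable_sin.comp (differentiable_apply 2))

end GeodesicEquation

theorem hasDerivAt_vec3 {f g h : ℝ → ℝ} {f' g' h' s : ℝ} (hf : HasDerivAt f f' s)
    (hg : HasDerivAt g g' s) (hh : HasDerivAt h h' s) :
    HasDerivAt (fun s => ![f s, g s, h s]) ![f', g', h'] s := by
  rw [hasDerivAt_pi]
  intro i
  fin_cases i
  exacts [hf, hg, hh]

/-- The `(t, x, φ)`-coordinates of the null vector with time component `1` over the unit vector
of `Σ` at axial coordinate `x` that makes the angle `θ` with the parallel. -/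
def nullDirection (r : ℝ → ℝ) (x θ : ℝ) : Fin 3 → ℝ :=
  ![1, Real.sin θ / meridianSpeed r x, Real.cos θ / r x]

/-- The curve in `M` over the curve `s ↦ (x s, φ s)` of `Σ`, with time coordinate `t₀ + s`. -/
def nullLift (r : ℝ → ℝ) (t₀ : ℝ) (x φ : ℝ → ℝ) (s : ℝ) : ℝ × E3 := coords r ![t₀ + s, x s, φ s]

namespace IsUnitSpeedGeodesic

variable {r ρ x θ φ : ℝ → ℝ} {s : ℝ}

theorem hasDerivAt_coordinates (h : IsUnitSpeedGeodesic ρ x θ φ) (t₀ s : ℝ) :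
    HasDerivAt (fun s => ![t₀ + s, x s, φ s]) (nullDirection ρ (x s) (θ s)) s :=
  hasDerivAt_vec3 ((hasDerivAt_id s).const_add t₀) (h.hasDerivAt_axial s) (h.hasDerivAt_longitude s)

theorem contDiff_coordinates (h : IsUnitSpeedGeodesic ρ x θ φ) (hρ : ContDiff ℝ 2 ρ)
    (hpos : ∀ x, 0 < ρ x) (t₀ : ℝ) : ContDiff ℝ 2 fun s => ![t₀ + s, x s, φ s] := by
  have hz := h.contDiff hρ hpos
  rw [contDiff_pi]
  intro i
  fin_cases i
  · exact contDiff_const.add contDiff_id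
  · exact contDiff_fst.comp hz
  · exact contDiff_snd.comp (contDiff_snd.comp hz)

theorem geodesicEqAt_coordinates (h : IsUnitSpeedGeodesic ρ x θ φ) (hρ : ContDiff ℝ 2 ρ)
    (hpos : ∀ x, 0 < ρ x) (t₀ s : ℝ) :
    GeodesicEqAt (metricCoeff ρ) (fun s => ![t₀ + s, x s, φ s]) s := by
  have hρ1 : HasDerivAt ρ (deriv ρ (x s)) (x s) := (hρ.differentiable two_ne_zero _).hasDerivAt
  have hd : deriv (fun s => ![t₀ + s, x s, φ s]) = fun s => nullDirection ρ (x s) (θ s) :=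
    funext fun s => (h.hasDerivAt_coordinates t₀ s).deriv
  have hd2 : HasDerivAt (fun s => nullDirection ρ (x s) (θ s)) _ s :=
    hasDerivAt_vec3 (hasDerivAt_const s (1 : ℝ))
      ((h.hasDerivAt_angle s).sin.div
        ((hasDerivAt_meridianSpeed hρ _).comp s (h.hasDerivAt_axial s)) (meridianSpeed_pos ρ _).ne')
      ((h.hasDerivAt_angle s).cos.div (hρ1.comp s (h.hasDerivAt_axial s)) (hpos _).ne')
  have hρx := (hpos (x s)).ne'
  have hσx := (meridianSpeed_pos ρ (x s)).ne'
  rw [geodesicEqAt_iff hρ hρx, hd, hd2.deriv]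
  simp only [nullDirection, Matrix.cons_val_zero, Matrix.cons_val_one, Matrix.cons_val,
    ← meridianSpeed_sq]
  refine ⟨trivial, ?_, ?_⟩ <;> field_simp <;> ring

theorem isGeodesicOn_nullLift (h : IsUnitSpeedGeodesic ρ x θ φ) (hρ : ContDiff ℝ 2 ρ)
    (hpos : ∀ x, 0 < ρ x) (hr : ContDiff ℝ 2 r) (t₀ : ℝ) {J : Set ℝ}
    (hJ : ∀ s ∈ J, x s ∈ Ioo 0 1 ∧ ρ =ᶠ[𝓝 (x s)] r) : IsGeodesicOn r (nullLift r t₀ x φ) J := by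
  intro s hs
  obtain ⟨hx, he⟩ := hJ s hs
  refine ⟨fun s => ![t₀ + s, x s, φ s], (h.contDiff_coordinates hρ hpos t₀).contDiffAt, ?_, ?_⟩
  · filter_upwards [h.continuous_axial.continuousAt (isOpen_Ioo.mem_nhds hx)] with u hu
    exact ⟨hu, rfl⟩
  · have hρx : ρ (x s) ≠ 0 := (hpos _).ne'
    have hgeo := h.geodesicEqAt_coordinates hρ hpos t₀ s
    rw [geodesicEqAt_iff hρ hρx] at hgeo
    rw [geodesicEqAt_iff hr (he.eq_of_nhds ▸ hρx)]
    simpa only [Matrix.cons_val_one, Matrix.cons_val_zero, he.eq_of_nhds, he.deriv_eq,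
      he.deriv.deriv_eq] using hgeo

theorem deriv_nullLift (h : IsUnitSpeedGeodesic ρ x θ φ) (hr : Differentiable ℝ r) (t₀ : ℝ)
    (he : ρ =ᶠ[𝓝 (x s)] r) :
    deriv (nullLift r t₀ x φ) s =
      fderiv ℝ (coords r) ![t₀ + s, x s, φ s] (nullDirection r (x s) (θ s)) := by
  have hdir : nullDirection ρ (x s) (θ s) = nullDirection r (x s) (θ s) := by
    simp only [nullDirection, meridianSpeed, he.eq_of_nhds, he.deriv_eq]
  exact hdir ▸ ((differentiable_coords hr _).hasFDerivAt.comp_hasDerivAt s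
    (h.hasDerivAt_coordinates t₀ s)).deriv

end IsUnitSpeedGeodesic

/-! ### Conservation of angular momentum and energy -/

/-- The angular momentum of the velocity `v` at the point `p` about the axis of revolution. -/
def angularMomentum (p v : ℝ × E3) : ℝ := p.2 1 * v.2 2 - p.2 2 * v.2 1

section Coordinates

variable {r : ℝ → ℝ}

theorem angularMomentum_coords (hr : Differentiable ℝ r) (q u : Fin 3 → ℝ) :
    angularMomentum (coords r q) (fderiv ℝ (coords r) q u) = r (q 1) ^ 2 * u 2 := by
  rw [fderiv_coords_apply hr]
  simp only [angularMomentum, coords, param, PiLp.toLp_apply, Matrix.cons_val_one,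
    Matrix.cons_val_zero, Matrix.cons_val]
  linear_combination r (q 1) ^ 2 * u 2 * Real.sin_sq_add_cos_sq (q 2)

theorem inner_fderiv_coords (hr : Differentiable ℝ r) (q u : Fin 3 → ℝ) :
    inner ℝ (fderiv ℝ (coords r) q u).2 (fderiv ℝ (coords r) q u).2 =
      meridianSpeed r (q 1) ^ 2 * u 1 ^ 2 + r (q 1) ^ 2 * u 2 ^ 2 := by
  rw [fderiv_coords_apply hr, meridianSpeed_sq]
  simp only [PiLp.inner_apply, Fin.sum_univ_three, RCLike.inner_apply, conj_trivial,
    Matrix.cons_val_one, Matrix.cons_val_zero, Matrix.cons_val]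
  linear_combination ((deriv r (q 1) * u 1) ^ 2 + r (q 1) ^ 2 * u 2 ^ 2) *
    Real.sin_sq_add_cos_sq (q 2)

theorem axial_ne_zero_of_angularMomentum_eq_zero (hr : Differentiable ℝ r)
    (hpos : ∀ x ∈ Ioo (0 : ℝ) 1, 0 < r x) {p v : ℝ × E3} (hv : v ∈ tangentSpace r p)
    (hL : angularMomentum p v = 0) (hv0 : v.2 ≠ 0) : v.2 0 ≠ 0 := by
  obtain ⟨q, hq, rfl, u, rfl⟩ := hv
  rw [angularMomentum_coords hr] at hL
  have hu2 : u 2 = 0 := (mul_eq_zero.1 hL).resolve_left (pow_ne_zero 2 (hpos _ hq).ne')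
  intro hx
  have hu1 : u 1 = 0 := by simpa [fderiv_coords_apply hr] using hx
  exact hv0 (inner_self_eq_zero (𝕜 := ℝ).1 (by rw [inner_fderiv_coords hr, hu1, hu2]; ring))

end Coordinates

namespace IsGeodesicOn

variable {r : ℝ → ℝ} {γ : ℝ → ℝ × E3} {J : Set ℝ} {s t : ℝ}

theorem exists_coordinates (h : IsGeodesicOn r γ J) (hr : Differentiable ℝ r) (ht : t ∈ J) :
    ∃ c : ℝ → Fin 3 → ℝ, c t ∈ coordDomain ∧
      (∀ i, HasDerivAt (fun s => c s i) (deriv c t i) t) ∧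
      (∀ i, HasDerivAt (fun s => deriv c s i) (deriv (deriv c) t i) t) ∧
      GeodesicEqAt (metricCoeff r) c t ∧
      ∀ᶠ s in 𝓝 t, γ s = coords r (c s) ∧ deriv γ s = fderiv ℝ (coords r) (c s) (deriv c s) := by
  obtain ⟨c, hc, hev, heq⟩ := h t ht
  have hc1 : HasDerivAt c (deriv c t) t := (hc.differentiableAt two_ne_zero).hasDerivAt
  have hc2 : HasDerivAt (deriv c) (deriv (deriv c) t) t :=
    ((hc.derivWithin (m := 1) (by norm_num)).differentiableAt one_ne_zero).hasDerivAt
  refine ⟨c, hev.self_of_nhds.1, hasDerivAt_pi.1 hc1, hasDerivAt_pi.1 hc2, heq, ?_⟩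
  have hd : ∀ᶠ s in 𝓝 t, DifferentiableAt ℝ c s :=
    (hc.eventually (by simp)).mono fun s hs => hs.differentiableAt two_ne_zero
  filter_upwards [hev.eventually_nhds, hd] with s hs hds
  have hγ : γ =ᶠ[𝓝 s] coords r ∘ c := hs.mono fun u hu => hu.2
  exact ⟨hγ.eq_of_nhds, hγ.deriv_eq.trans
    ((differentiable_coords hr _).hasFDerivAt.comp_hasDerivAt s hds.hasDerivAt).deriv⟩

theorem deriv_mem_tangentSpace (h : IsGeodesicOn r γ J) (hr : Differentiable ℝ r) (ht : t ∈ J) :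
    deriv γ t ∈ tangentSpace r (γ t) := by
  obtain ⟨c, hct, -, -, -, hev⟩ := h.exists_coordinates hr ht
  obtain ⟨hγ, hγ'⟩ := hev.self_of_nhds
  exact ⟨c t, hct, hγ.symm, deriv c t, hγ'.symm⟩

theorem continuousAt_deriv_axial (h : IsGeodesicOn r γ J) (hr : Differentiable ℝ r) (ht : t ∈ J) :
    ContinuousAt (fun s => (deriv γ s).2 0) t := by
  obtain ⟨c, -, -, hc2, -, hev⟩ := h.exists_coordinates hr ht
  refine (hc2 1).continuousAt.congr ?_
  filter_upwards [hev] with s hs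
  rw [hs.2, fderiv_coords_apply hr]
  rfl

theorem hasDerivAt_angularMomentum (h : IsGeodesicOn r γ J) (hr : ContDiff ℝ 2 r)
    (hpos : ∀ x ∈ Ioo (0 : ℝ) 1, 0 < r x) (ht : t ∈ J) :
    HasDerivAt (fun s => angularMomentum (γ s) (deriv γ s)) 0 t := by
  have hrd : Differentiable ℝ r := hr.differentiable two_ne_zero
  obtain ⟨c, hct, hc1, hc2, heq, hev⟩ := h.exists_coordinates hrd ht
  have hrt : r (c t 1) ≠ 0 := (hpos _ hct).ne'
  obtain ⟨-, -, hφ⟩ := (geodesicEqAt_iff hr hrt).1 heq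
  have hd : HasDerivAt (fun s => r (c s 1) ^ 2 * deriv c s 2) 0 t := by
    refine ((((hrd _).hasDerivAt.comp t (hc1 1)).pow 2).mul (hc2 2)).congr_deriv ?_
    simp only [Function.comp, Pi.pow_apply]
    field_simp at hφ
    linear_combination r (c t 1) * hφ
  refine hd.congr_of_eventuallyEq ?_
  filter_upwards [hev] with s hs
  rw [hs.1, hs.2, angularMomentum_coords hrd]

theorem hasDerivAt_energy (h : IsGeodesicOn r γ J) (hr : ContDiff ℝ 2 r)
    (hpos : ∀ x ∈ Ioo (0 : ℝ) 1, 0 < r x) (ht : t ∈ J) :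
    HasDerivAt (fun s => inner ℝ (deriv γ s).2 (deriv γ s).2) 0 t := by
  have hrd : Differentiable ℝ r := hr.differentiable two_ne_zero
  have hr' : ContDiff ℝ 1 (deriv r) := hr.deriv'
  obtain ⟨c, hct, hc1, hc2, heq, hev⟩ := h.exists_coordinates hrd ht
  have hrt : r (c t 1) ≠ 0 := (hpos _ hct).ne'
  have hσt : 1 + deriv r (c t 1) ^ 2 ≠ 0 := by positivity
  obtain ⟨-, hx, hφ⟩ := (geodesicEqAt_iff hr hrt).1 heq
  have hd : HasDerivAt (fun s => (1 + deriv r (c s 1) ^ 2) * deriv c s 1 ^ 2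
      + r (c s 1) ^ 2 * deriv c s 2 ^ 2) 0 t := by
    have hrc := (hrd (c t 1)).hasDerivAt.comp t (hc1 1)
    have hrc' := (hr'.differentiable one_ne_zero (c t 1)).hasDerivAt.comp t (hc1 1)
    refine ((((hrc'.pow 2).const_add 1).mul ((hc2 1).pow 2)).add
      ((hrc.pow 2).mul ((hc2 2).pow 2))).congr_deriv ?_
    simp only [Function.comp, Pi.pow_apply]
    field_simp at hφ hx
    linear_combination 2 * deriv c t 1 * hx + 2 * r (c t 1) * deriv c t 2 * hφ
  refine hd.congr_of_eventuallyEq ?_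
  filter_upwards [hev] with s hs
  rw [hs.2, inner_fderiv_coords hrd, meridianSpeed_sq]

theorem angularMomentum_eq (h : IsGeodesicOn r γ J) (hr : ContDiff ℝ 2 r)
    (hpos : ∀ x ∈ Ioo (0 : ℝ) 1, 0 < r x) (hJ : IsOpen J) (hJc : J.OrdConnected)
    (hs : s ∈ J) (ht : t ∈ J) :
    angularMomentum (γ s) (deriv γ s) = angularMomentum (γ t) (deriv γ t) :=
  have hd := fun u (hu : u ∈ J) => h.hasDerivAt_angularMomentum hr hpos hu
  hJ.is_const_of_deriv_eq_zero hJc.isPreconnected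
    (fun u hu => (hd u hu).differentiableAt.differentiableWithinAt)
    (fun u hu => (hd u hu).deriv) hs ht

theorem energy_eq (h : IsGeodesicOn r γ J) (hr : ContDiff ℝ 2 r)
    (hpos : ∀ x ∈ Ioo (0 : ℝ) 1, 0 < r x) (hJ : IsOpen J) (hJc : J.OrdConnected)
    (hs : s ∈ J) (ht : t ∈ J) :
    inner ℝ (deriv γ s).2 (deriv γ s).2 = inner ℝ (deriv γ t).2 (deriv γ t).2 :=
  have hd := fun u (hu : u ∈ J) => h.hasDerivAt_energy hr hpos hu
  hJ.is_const_of_deriv_eq_zero hJc.isPreconnected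
    (fun u hu => (hd u hu).differentiableAt.differentiableWithinAt)
    (fun u hu => (hd u hu).deriv) hs ht

end IsGeodesicOn

/-! ### Outgoing meridians -/

/-- The vector `v` at the point `p` projects to a vector on `Σ` that is tangent to a meridian and
points towards increasing `x`. -/
def IsOutgoing (p v : ℝ × E3) : Prop := angularMomentum p v = 0 ∧ 0 < v.2 0

theorem isOutgoing_smul_iff {a : ℝ} (ha : 0 < a) {p v : ℝ × E3} :
    IsOutgoing p (a • v) ↔ IsOutgoing p v := by
  have hL : angularMomentum p (a • v) = a * angularMomentum p v := by
    simp only [angularMomentum, Prod.smul_snd, PiLp.smul_apply, smul_eq_mul]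
    ring
  simp only [IsOutgoing, hL, Prod.smul_snd, PiLp.smul_apply, smul_eq_mul, mul_eq_zero, ha.ne',
    false_or, mul_pos_iff_of_pos_left ha]

theorem IsGeodesicOn.isOutgoing {r : ℝ → ℝ} {γ : ℝ → ℝ × E3} {J : Set ℝ} {s t : ℝ}
    (h : IsGeodesicOn r γ J) (hr : ContDiff ℝ 2 r) (hpos : ∀ x ∈ Ioo (0 : ℝ) 1, 0 < r x)
    (hJ : IsOpen J) (hJc : J.OrdConnected) (hs : s ∈ J) (ht : t ∈ J)
    (hout : IsOutgoing (γ s) (deriv γ s)) : IsOutgoing (γ t) (deriv γ t) := by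
  obtain ⟨hL, hx⟩ := hout
  have hrd : Differentiable ℝ r := hr.differentiable two_ne_zero
  have hL' : ∀ u ∈ J, angularMomentum (γ u) (deriv γ u) = 0 := fun u hu =>
    (h.angularMomentum_eq hr hpos hJ hJc hu hs).trans hL
  have hs0 : (deriv γ s).2 ≠ 0 := fun h0 => hx.ne' (by rw [h0]; rfl)
  have hu0 : ∀ u ∈ J, (deriv γ u).2 ≠ 0 := fun u hu => by
    rwa [Ne, ← inner_self_eq_zero (𝕜 := ℝ), h.energy_eq hr hpos hJ hJc hu hs, inner_self_eq_zero]
  have hne : ∀ u ∈ J, (deriv γ u).2 0 ≠ 0 := fun u hu =>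
    axial_ne_zero_of_angularMomentum_eq_zero hrd hpos (h.deriv_mem_tangentSpace hrd hu)
      (hL' u hu) (hu0 u hu)
  have hcont : ContinuousOn (fun u => (deriv γ u).2 0) J := fun u hu =>
    (h.continuousAt_deriv_axial hrd hu).continuousWithinAt
  refine ⟨hL' t ht, ?_⟩
  by_contra! hle
  obtain ⟨u, hu, hu0⟩ := hJc.isPreconnected.intermediate_value ht hs hcont ⟨hle, hx.le⟩
  exact hne u hu hu0

section NullGeodesicSpace

variable {r : ℝ → ℝ}

theorem SameLeaf.isOutgoing_iff {v w : FutureNullCone r} (h : SameLeaf r v w)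
    (hr : ContDiff ℝ 2 r) (hpos : ∀ x ∈ Ioo (0 : ℝ) 1, 0 < r x) :
    IsOutgoing v.1.1 v.1.2 ↔ IsOutgoing w.1.1 w.1.2 := by
  obtain ⟨γ, J, hJ, hJc, hγ, s, hs, t, ht, a, ha, ⟨hv, hv'⟩, hw, hw'⟩ := h
  rw [← hv, ← hv', ← isOutgoing_smul_iff ha (v := w.1.2), ← hw, ← hw']
  exact ⟨hγ.isOutgoing hr hpos hJ hJc hs ht, hγ.isOutgoing hr hpos hJ hJc ht hs⟩

theorem isOutgoing_iff_of_toNullGeodesic_eq (hr : ContDiff ℝ 2 r)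
    (hpos : ∀ x ∈ Ioo (0 : ℝ) 1, 0 < r x) {v w : FutureNullCone r}
    (h : toNullGeodesic v = toNullGeodesic w) :
    IsOutgoing v.1.1 v.1.2 ↔ IsOutgoing w.1.1 w.1.2 :=
  iff_of_eq <| congrArg (Quot.lift (fun v : FutureNullCone r => IsOutgoing v.1.1 v.1.2)
    fun _ _ h => propext (h.isOutgoing_iff hr hpos)) h

end NullGeodesicSpace

/-! ### Null vectors over a parallel -/

section NullDirection

variable {r : ℝ → ℝ}

theorem fderiv_coords_fst (hr : Differentiable ℝ r) (q u : Fin 3 → ℝ) :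
    (fderiv ℝ (coords r) q u).1 = u 0 := by
  rw [fderiv_coords_apply hr]

theorem fderiv_coords_axial (hr : Differentiable ℝ r) (q u : Fin 3 → ℝ) :
    (fderiv ℝ (coords r) q u).2 0 = u 1 := by
  rw [fderiv_coords_apply hr]
  rfl

theorem lorentz_nullDirection (hr : Differentiable ℝ r) {q : Fin 3 → ℝ} (hq : r (q 1) ≠ 0)
    (θ : ℝ) :
    lorentz (fderiv ℝ (coords r) q (nullDirection r (q 1) θ))
      (fderiv ℝ (coords r) q (nullDirection r (q 1) θ)) = 0 := by
  have hσ := (meridianSpeed_pos r (q 1)).ne'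
  rw [lorentz, inner_fderiv_coords hr, fderiv_coords_fst hr]
  simp only [nullDirection, Matrix.cons_val_zero, Matrix.cons_val_one, Matrix.cons_val]
  field_simp
  linear_combination Real.sin_sq_add_cos_sq θ

theorem continuous_nullDirection (r : ℝ → ℝ) (x : ℝ) : Continuous (nullDirection r x) :=
  continuous_pi fun i => by
    fin_cases i
    · exact continuous_const
    · exact Real.continuous_sin.div_const _
    · exact Real.continuous_cos.div_const _

theorem contDiff_coords {n : WithTop ℕ∞} (hr : ContDiff ℝ n r) : ContDiff ℝ n (coords r) := by
  refine ContDiff.prodMk (by fun_prop) (contDiff_euclidean.2 fun i => ?_)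
  fin_cases i
  · exact contDiff_apply ℝ ℝ 1
  · exact (hr.comp (contDiff_apply ℝ ℝ 1)).mul (Real.contDiff_cos.comp (contDiff_apply ℝ ℝ 2))
  · exact (hr.comp (contDiff_apply ℝ ℝ 1)).mul (Real.contDiff_sin.comp (contDiff_apply ℝ ℝ 2))

end NullDirection

/-- The future pointing null vector with time component `1` at the point of `M` with coordinates
`(t, a, φ)` whose projection to `Σ` makes the angle `θ` with the parallel, as a function of
`(t, φ, θ)`. -/
def nullVector {r : ℝ → ℝ} (hr : ContDiff ℝ 2 r) (hpos : ∀ x ∈ Ioo (0 : ℝ) 1, 0 < r x) {a : ℝ}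
    (ha : a ∈ Ioo (0 : ℝ) 1) (p : ℝ × ℝ × ℝ) : FutureNullCone r :=
  have hrd : Differentiable ℝ r := hr.differentiable two_ne_zero
  have htime : (fderiv ℝ (coords r) ![p.1, a, p.2.1] (nullDirection r a p.2.2)).1 = 1 :=
    fderiv_coords_fst hrd _ _
  ⟨(coords r ![p.1, a, p.2.1], fderiv ℝ (coords r) ![p.1, a, p.2.1] (nullDirection r a p.2.2)),
    ⟨trivial, a, ha, p.2.1, rfl⟩, ⟨_, ha, rfl, _, rfl⟩,
    lorentz_nullDirection hrd (q := ![p.1, a, p.2.1]) (hpos a ha).ne' _,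
    fun h => one_ne_zero (htime.symm.trans (congrArg Prod.fst h)),
    by simp [lorentz, htime]⟩

section NullVector

variable {r : ℝ → ℝ} (hr : ContDiff ℝ 2 r) (hpos : ∀ x ∈ Ioo (0 : ℝ) 1, 0 < r x) {a : ℝ}
  (ha : a ∈ Ioo (0 : ℝ) 1)

theorem continuous_nullVector : Continuous (nullVector hr hpos ha) := by
  have hq : Continuous fun p : ℝ × ℝ × ℝ => ![p.1, a, p.2.1] := continuous_pi fun i => by
    fin_cases i
    exacts [continuous_fst, continuous_const, continuous_fst.comp continuous_snd]
  have hc : ContDiff ℝ 2 (coords r) := contDiff_coords hr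
  exact Continuous.subtype_mk ((hc.continuous.comp hq).prodMk
    (((hc.continuous_fderiv two_ne_zero).comp hq).clm_apply
      ((continuous_nullDirection r a).comp (continuous_snd.comp continuous_snd)))) _

theorem nullVector_congr {t φ θ φ' θ' : ℝ} (hφc : Real.cos φ' = Real.cos φ)
    (hφs : Real.sin φ' = Real.sin φ) (hθc : Real.cos θ' = Real.cos θ)
    (hθs : Real.sin θ' = Real.sin θ) :
    nullVector hr hpos ha (t, φ', θ') = nullVector hr hpos ha (t, φ, θ) :=
  Subtype.ext <| by
    simp [nullVector, nullDirection, fderiv_coords_apply (hr.differentiable two_ne_zero), coords,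
      param, hφc, hφs, hθc, hθs]

theorem isOutgoing_nullVector_iff {t φ θ : ℝ} (hθ : Real.cos θ = 0) :
    IsOutgoing (nullVector hr hpos ha (t, φ, θ)).1.1 (nullVector hr hpos ha (t, φ, θ)).1.2 ↔
      0 < Real.sin θ := by
  have hrd : Differentiable ℝ r := hr.differentiable two_ne_zero
  simp only [IsOutgoing, nullVector, angularMomentum_coords hrd, fderiv_coords_axial hrd]
  simp [nullDirection, hθ, meridianSpeed_pos]

end NullVector

namespace IsUnitSpeedGeodesic

variable {r ρ x θ φ : ℝ → ℝ} {a s t : ℝ}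

theorem isVelocity_nullLift (h : IsUnitSpeedGeodesic ρ x θ φ) (hr : ContDiff ℝ 2 r)
    (hpos : ∀ x ∈ Ioo (0 : ℝ) 1, 0 < r x) (ha : a ∈ Ioo (0 : ℝ) 1) (t₀ : ℝ)
    (he : ρ =ᶠ[𝓝 (x s)] r) (hs : x s = a) :
    IsVelocity (nullLift r t₀ x φ) s (nullVector hr hpos ha (t₀ + s, φ s, θ s)) := by
  subst hs
  exact ⟨rfl, h.deriv_nullLift (hr.differentiable two_ne_zero) t₀ he⟩

theorem exists_isGeodesicOn_nullLift (h : IsUnitSpeedGeodesic ρ x θ φ) (hρ : ContDiff ℝ 2 ρ)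
    (hpos : ∀ x, 0 < ρ x) (hr : ContDiff ℝ 2 r) (t₀ : ℝ) (hst : s ≤ t)
    (hI : ∀ u ∈ Icc s t, x u ∈ Ioo 0 1 ∧ ρ =ᶠ[𝓝 (x u)] r) :
    ∃ J, IsOpen J ∧ J.OrdConnected ∧ Icc s t ⊆ J ∧ (∀ u ∈ J, x u ∈ Ioo 0 1) ∧
      IsGeodesicOn r (nullLift r t₀ x φ) J := by
  have hU : IsOpen (x ⁻¹' (Ioo 0 1 ∩ {y | ρ =ᶠ[𝓝 y] r})) :=
    (isOpen_Ioo.inter isOpen_setOfPred_eventually_nhds).preimage h.continuous_axial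
  obtain ⟨J, hJ, hJc, hIJ, hJU⟩ := exists_isOpen_ordConnected_of_Icc_subset hst hU hI
  exact ⟨J, hJ, hJc, hIJ, fun u hu => (hJU hu).1, h.isGeodesicOn_nullLift hρ hpos hr t₀ hJU⟩

theorem toNullGeodesic_nullVector_eq (h : IsUnitSpeedGeodesic ρ x θ φ) (hρ : ContDiff ℝ 2 ρ)
    (hρpos : ∀ x, 0 < ρ x) (hr : ContDiff ℝ 2 r) (hpos : ∀ x ∈ Ioo (0 : ℝ) 1, 0 < r x)
    (ha : a ∈ Ioo (0 : ℝ) 1) (hst : s ≤ t)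
    (hI : ∀ u ∈ Icc s t, x u ∈ Ioo 0 1 ∧ ρ =ᶠ[𝓝 (x u)] r) (hs : x s = a) (ht : x t = a) :
    toNullGeodesic (nullVector hr hpos ha (s, φ s, θ s)) =
      toNullGeodesic (nullVector hr hpos ha (t, φ t, θ t)) := by
  have hsI := left_mem_Icc.2 hst
  have htI := right_mem_Icc.2 hst
  obtain ⟨J, hJ, hJc, hIJ, -, hgeo⟩ := h.exists_isGeodesicOn_nullLift hρ hρpos hr 0 hst hI
  have hv := h.isVelocity_nullLift hr hpos ha 0 (hI s hsI).2 hs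
  have hw := h.isVelocity_nullLift hr hpos ha 0 (hI t htI).2 ht
  rw [zero_add] at hv hw
  exact Quot.sound ⟨_, J, hJ, hJc, hgeo, s, hIJ hsI, t, hIJ htI, 1, one_pos, hv, hw.1,
    hw.2.trans (one_smul ℝ _).symm⟩

theorem longitude_eq_of_cos_angle_eq_zero (h : IsUnitSpeedGeodesic ρ x θ φ)
    (hρ : Differentiable ℝ ρ) (hpos : ∀ x, 0 < ρ x) (hs : Real.cos (θ s) = 0) (t : ℝ) :
    φ t = φ s := by
  have hcos (u : ℝ) : Real.cos (θ u) = 0 := by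
    have hcl := h.clairaut hρ hpos u s
    rw [hs, mul_zero] at hcl
    exact (mul_eq_zero.1 hcl).resolve_left (hpos _).ne'
  refine is_const_of_deriv_eq_zero (fun u => (h.hasDerivAt_longitude u).differentiableAt)
    (fun u => ?_) t s
  rw [(h.hasDerivAt_longitude u).deriv, hcos, zero_div]

end IsUnitSpeedGeodesic

theorem exists_profile {r : ℝ → ℝ} (hr : ContDiff ℝ 2 r) (hpos : ∀ x ∈ Ioo (0 : ℝ) 1, 0 < r x)
    {a b : ℝ} (ha : 0 < a) (hb : b < 1) :
    ∃ ρ, ContDiff ℝ 2 ρ ∧ (∀ x, 0 < ρ x) ∧ (HasCompactSupport fun x => ρ x - 1) ∧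
      ∀ y ∈ Icc a b, ρ =ᶠ[𝓝 y] r := by
  obtain ⟨ρ, hρ, hρpos, hcs, he⟩ := exists_contDiff_forall_pos_eventuallyEq_nhdsSet (n := 2) hr
    isCompact_Icc isOpen_Ioo (Icc_subset_Ioo ha hb) hpos
  exact ⟨ρ, hρ, hρpos, hcs, eventually_nhdsSet_iff_forall.1 he⟩

theorem isOverMeridian_nullVector {r : ℝ → ℝ} (hr : ContDiff ℝ 2 r)
    (hpos : ∀ x ∈ Ioo (0 : ℝ) 1, 0 < r x) {a : ℝ} (ha : a ∈ Ioo (0 : ℝ) 1) {t φ θ : ℝ}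
    (hθ : Real.cos θ = 0) : IsOverMeridian (toNullGeodesic (nullVector hr hpos ha (t, φ, θ))) := by
  obtain ⟨ρ, hρ, hρpos, hcs, he⟩ := exists_profile hr hpos ha.1 ha.2
  have hea : ρ =ᶠ[𝓝 a] r := he a (left_mem_Icc.2 le_rfl)
  obtain ⟨x, θ', φ', hgeo, hx0, hθ0, hφ0⟩ := exists_isUnitSpeedGeodesic hρ hρpos hcs a θ φ
  have hI : ∀ u ∈ Icc (0 : ℝ) 0, x u ∈ Ioo 0 1 ∧ ρ =ᶠ[𝓝 (x u)] r := by
    intro u hu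
    obtain rfl : u = 0 := le_antisymm hu.2 hu.1
    exact hx0 ▸ ⟨ha, hea⟩
  obtain ⟨J, hJ, hJc, hIJ, hxJ, hJgeo⟩ :=
    hgeo.exists_isGeodesicOn_nullLift hρ hρpos hr t le_rfl hI
  have hv := hgeo.isVelocity_nullLift hr hpos ha t (hx0 ▸ hea) hx0
  rw [add_zero, hφ0, hθ0] at hv
  refine ⟨_, J, φ, hJ, hJc, hJgeo, fun s hs => ⟨x s, hxJ s hs, ?_⟩, 0,
    hIJ (left_mem_Icc.2 le_rfl), _, hv, rfl⟩
  have hφ : φ' s = φ := (hgeo.longitude_eq_of_cos_angle_eq_zero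
    (hρ.differentiable two_ne_zero) hρpos (hθ0 ▸ hθ) s).trans hφ0
  rw [← hφ]
  rfl

/-! ### Null geodesics with two limits -/

theorem exists_turning_point {r : ℝ → ℝ} (hr : Continuous r)
    (hpos : ∀ x ∈ Ioo (0 : ℝ) 1, 0 < r x) (h1 : r 1 = 0) {a : ℝ} (ha : a ∈ Ioo (0 : ℝ) 1) {ε : ℝ}
    (hε : 0 < ε) :
    ∃ b ∈ Ioo a 1, r b < ε ∧ IsMinOn (fun y => r y ^ 2 * y) (Icc a b) b := by
  have hg : Continuous fun y => r y ^ 2 * y := by fun_prop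
  have hlim : Tendsto (fun y => r y ^ 2 * y) (𝓝[<] 1) (𝓝 0) := by
    simpa [h1] using (hg.tendsto 1).mono_left nhdsWithin_le_nhds
  have hga : 0 < r a ^ 2 * a := mul_pos (pow_pos (hpos a ha) 2) ha.1
  have hεa : 0 < ε ^ 2 * a := mul_pos (pow_pos hε 2) ha.1
  obtain ⟨y₀, hy₀, hay₀, hy₀1⟩ := ((hlim.eventually_lt_const (lt_min hεa hga)).and
    (Ioo_mem_nhdsLT ha.2)).exists
  obtain ⟨b, hb, hmin⟩ := isCompact_Icc.exists_isMinOn (nonempty_Icc.2 hay₀.le) hg.continuousOn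
  have hgb : r b ^ 2 * b < min (ε ^ 2 * a) (r a ^ 2 * a) :=
    (hmin (right_mem_Icc.2 hay₀.le)).trans_lt hy₀
  have hab : a < b := lt_of_le_of_ne hb.1 fun h => (hgb.trans_le (min_le_right _ _)).ne (by rw [h])
  have hrb : r b ^ 2 < ε ^ 2 := by
    have hlt : r b ^ 2 * b < ε ^ 2 * b :=
      (hgb.trans_le (min_le_left _ _)).trans_le (by gcongr)
    exact lt_of_mul_lt_mul_right hlt (ha.1.trans hab).le
  exact ⟨b, ⟨hab, hb.2.trans_lt hy₀1⟩, lt_of_pow_lt_pow_left₀ 2 hε.le hrb,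
    hmin.on_subset (Icc_subset_Icc_right hb.2)⟩

theorem exists_bouncing_geodesic {r : ℝ → ℝ} (hr : ContDiff ℝ 2 r)
    (hpos : ∀ x ∈ Ioo (0 : ℝ) 1, 0 < r x) (h1 : r 1 = 0) {a : ℝ} (ha : a ∈ Ioo (0 : ℝ) 1) {K : ℝ}
    (hK : ∀ y ∈ Icc 0 1, meridianSpeed r y ≤ K) {ε : ℝ} (hε : 0 < ε) :
    ∃ ρ x θ φ, IsUnitSpeedGeodesic ρ x θ φ ∧ ContDiff ℝ 2 ρ ∧ (∀ y, 0 < ρ y) ∧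
      ∃ s ∈ Icc (-(2 * K)) 0, ∃ t ∈ Icc 0 (2 * K), x s = a ∧ 0 < Real.sin (θ s) ∧
        x t = a ∧ Real.sin (θ t) < 0 ∧ (∀ u ∈ Icc s t, x u ∈ Ioo 0 1 ∧ ρ =ᶠ[𝓝 (x u)] r) ∧
        ∀ u, x u = a → |Real.cos (θ u)| < ε := by
  have hra : 0 < r a := hpos a ha
  obtain ⟨b, ⟨hab, hb1⟩, hrb, hmin⟩ := exists_turning_point hr.continuous hpos h1 ha
    (mul_pos hra hε)
  have hb : b ∈ Icc a b := right_mem_Icc.2 hab.le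
  have hsub : Icc a b ⊆ Ioo 0 1 := Icc_subset_Ioo ha.1 hb1
  obtain ⟨ρ, hρ, hρpos, hcs, he⟩ := exists_profile hr hpos ha.1 hb1
  have hρr : ∀ y ∈ Icc a b, ρ y = r y := fun y hy => (he y hy).eq_of_nhds
  have hρd : Differentiable ℝ ρ := hρ.differentiable two_ne_zero
  have hminρ : IsMinOn (fun y => ρ y ^ 2 * y) (Icc a b) b := fun y hy => by
    simpa only [mem_ofPred_eq, hρr y hy, hρr b hb] using hmin hy
  have hKρ : ∀ y ∈ Icc a b, meridianSpeed ρ y ≤ K := fun y hy => by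
    rw [meridianSpeed, (he y hy).deriv_eq]
    exact hK y (Ioo_subset_Icc_self (hsub hy))
  obtain ⟨x, θ, φ, hgeo, hx0, hθ0, -⟩ := exists_isUnitSpeedGeodesic hρ hρpos hcs b 0 0
  obtain ⟨s, hs, t, ht, hxs, hθs, hxt, hθt, hxI⟩ :=
    hgeo.exists_bounce hρd hρpos ha.1.le hb1.le hab hx0 hθ0 hminρ hKρ
  refine ⟨ρ, x, θ, φ, hgeo, hρ, hρpos, s, hs, t, ht, hxs, hθs, hxt, hθt,
    fun u hu => ⟨hsub (hxI u hu), he _ (hxI u hu)⟩, fun u hu => ?_⟩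
  have hcl := hgeo.clairaut hρd hρpos u 0
  rw [hu, hx0, hθ0, Real.cos_zero, mul_one, hρr a (left_mem_Icc.2 hab.le), hρr b hb] at hcl
  have hrb0 : 0 < r b := hpos b (hsub hb)
  have hcos : 0 < Real.cos (θ u) := pos_of_mul_pos_right (hcl ▸ hrb0) hra.le
  rw [abs_of_pos hcos]
  exact lt_of_mul_lt_mul_left (hcl ▸ hrb) hra.le

theorem exists_mem_Icc_cos_eq_sin_eq (θ : ℝ) :
    ∃ θ' ∈ Icc 0 (2 * Real.pi), Real.cos θ' = Real.cos θ ∧ Real.sin θ' = Real.sin θ := by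
  have h := toIcoMod_mem_Ico Real.two_pi_pos 0 θ
  rw [zero_add] at h
  exact ⟨toIcoMod Real.two_pi_pos 0 θ, ⟨h.1, h.2.le⟩, Real.cos_periodic.sub_zsmul_eq _,
    Real.sin_periodic.sub_zsmul_eq _⟩

/-- The parameters `(t, φ, θ)` of null vectors with time in `[-C, C]` and angles in `[0, 2π]`. -/
def parameterBox (C : ℝ) : Set (ℝ × ℝ × ℝ) :=
  Icc (-C) C ×ˢ Icc 0 (2 * Real.pi) ×ˢ Icc 0 (2 * Real.pi)

theorem isCompact_parameterBox (C : ℝ) : IsCompact (parameterBox C) :=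
  isCompact_Icc.prod (isCompact_Icc.prod isCompact_Icc)

section Limits

variable {r : ℝ → ℝ} (hr : ContDiff ℝ 2 r) (hpos : ∀ x ∈ Ioo (0 : ℝ) 1, 0 < r x) {a : ℝ}
  (ha : a ∈ Ioo (0 : ℝ) 1)

theorem exists_mem_parameterBox_nullVector_eq {C t : ℝ} (ht : t ∈ Icc (-C) C) (φ θ : ℝ) :
    ∃ p ∈ parameterBox C, nullVector hr hpos ha p = nullVector hr hpos ha (t, φ, θ) ∧
      Real.cos p.2.2 = Real.cos θ ∧ Real.sin p.2.2 = Real.sin θ := by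
  obtain ⟨φ', hφ', hφc, hφs⟩ := exists_mem_Icc_cos_eq_sin_eq φ
  obtain ⟨θ', hθ', hθc, hθs⟩ := exists_mem_Icc_cos_eq_sin_eq θ
  exact ⟨(t, φ', θ'), ⟨ht, hφ', hθ'⟩, nullVector_congr hr hpos ha hφc hφs hθc hθs, hθc, hθs⟩

theorem exists_nullVector_pair (h1 : r 1 = 0) {K : ℝ}
    (hK : ∀ y ∈ Icc 0 1, meridianSpeed r y ≤ K) {ε : ℝ} (hε : 0 < ε) :
    ∃ p ∈ parameterBox (2 * K), ∃ q ∈ parameterBox (2 * K),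
      toNullGeodesic (nullVector hr hpos ha p) = toNullGeodesic (nullVector hr hpos ha q) ∧
      |Real.cos p.2.2| < ε ∧ |Real.cos q.2.2| < ε ∧ 0 ≤ Real.sin p.2.2 ∧ Real.sin q.2.2 ≤ 0 := by
  obtain ⟨ρ, x, θ, φ, hgeo, hρ, hρpos, s, hs, t, ht, hxs, hθs, hxt, hθt, hI, hcos⟩ :=
    exists_bouncing_geodesic hr hpos h1 ha hK hε
  have hleaf := hgeo.toNullGeodesic_nullVector_eq hρ hρpos hr hpos ha (hs.2.trans ht.1) hI hxs hxt
  have hK0 : 0 ≤ 2 * K := ht.1.trans ht.2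
  obtain ⟨p, hp, hpv, hpc, hps⟩ := exists_mem_parameterBox_nullVector_eq hr hpos ha
    (Icc_subset_Icc_right hK0 hs) (φ s) (θ s)
  obtain ⟨q, hq, hqv, hqc, hqs⟩ := exists_mem_parameterBox_nullVector_eq hr hpos ha
    (Icc_subset_Icc_left (neg_nonpos.2 hK0) ht) (φ t) (θ t)
  exact ⟨p, hp, q, hq, by rw [hpv, hqv, hleaf], hpc ▸ hcos s hxs, hqc ▸ hcos t hxt,
    hps ▸ hθs.le, hqs ▸ hθt.le⟩

theorem toNullGeodesic_nullVector_ne {p q : ℝ × ℝ × ℝ} (hp : Real.cos p.2.2 = 0)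
    (hq : Real.cos q.2.2 = 0) (hp' : 0 ≤ Real.sin p.2.2) (hq' : Real.sin q.2.2 ≤ 0) :
    toNullGeodesic (nullVector hr hpos ha p) ≠ toNullGeodesic (nullVector hr hpos ha q) := by
  intro h
  have hne : Real.sin p.2.2 ≠ 0 := fun h0 => by
    simpa [h0, hp] using Real.sin_sq_add_cos_sq p.2.2
  have hiff := isOutgoing_iff_of_toNullGeodesic_eq hr hpos h
  rw [isOutgoing_nullVector_iff hr hpos ha hp, isOutgoing_nullVector_iff hr hpos ha hq] at hiff
  exact hq'.not_gt (hiff.1 (hp'.lt_of_ne' hne))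

end Limits

theorem cos_eq_zero_of_tendsto {X : Type*} [TopologicalSpace X] {f : X → ℝ} (hf : Continuous f)
    {p : ℕ → X} {p₀ : X} (hp : Tendsto p atTop (𝓝 p₀)) {ε : ℕ → ℝ} (hε : Tendsto ε atTop (𝓝 0))
    (h : ∀ n, |Real.cos (f (p n))| < ε n) : Real.cos (f p₀) = 0 :=
  tendsto_nhds_unique (((Real.continuous_cos.comp hf).tendsto p₀).comp hp)
    (squeeze_zero_norm (fun n => (h n).le) hε)

theorem exists_tendsto_two_limits {r : ℝ → ℝ} (hr : ContDiff ℝ 2 r)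
    (hpos : ∀ x ∈ Ioo (0 : ℝ) 1, 0 < r x) (h1 : r 1 = 0) :
    ∃ (κ : ℕ → NullGeodesicSpace r) (κ₁ κ₂ : NullGeodesicSpace r),
      Tendsto κ atTop (𝓝 κ₁) ∧ Tendsto κ atTop (𝓝 κ₂) ∧ κ₁ ≠ κ₂ ∧
      IsOverMeridian κ₁ ∧ IsOverMeridian κ₂ := by
  have ha : (1 / 2 : ℝ) ∈ Ioo (0 : ℝ) 1 := by norm_num
  obtain ⟨K, hK⟩ := (isCompact_Icc (a := (0 : ℝ)) (b := 1)).bddAbove_image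
    (contDiff_meridianSpeed hr).continuous.continuousOn
  choose p hp q hq hpq hpc hqc hps hqs using fun n : ℕ =>
    exists_nullVector_pair hr hpos ha h1 (fun y hy => hK (mem_image_of_mem _ hy))
      (Nat.one_div_pos_of_nat (α := ℝ) (n := n))
  obtain ⟨⟨p₀, q₀⟩, -, ψ, hψ, hlim⟩ :=
    ((isCompact_parameterBox (2 * K)).prod (isCompact_parameterBox (2 * K))).tendsto_subseq
      (x := fun n => (p n, q n)) fun n => ⟨hp n, hq n⟩
  have hlp : Tendsto (fun n => p (ψ n)) atTop (𝓝 p₀) := (continuous_fst.tendsto _).comp hlim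
  have hlq : Tendsto (fun n => q (ψ n)) atTop (𝓝 q₀) := (continuous_snd.tendsto _).comp hlim
  have hε : Tendsto (fun n => 1 / ((ψ n : ℝ) + 1)) atTop (𝓝 0) :=
    tendsto_one_div_add_atTop_nhds_zero_nat.comp hψ.tendsto_atTop
  have hθ : Continuous fun x : ℝ × ℝ × ℝ => x.2.2 := by fun_prop
  have hsin := Real.continuous_sin.comp hθ
  have hpc₀ : Real.cos p₀.2.2 = 0 := cos_eq_zero_of_tendsto hθ hlp hε fun n => hpc (ψ n)
  have hqc₀ : Real.cos q₀.2.2 = 0 := cos_eq_zero_of_tendsto hθ hlq hε fun n => hqc (ψ n)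
  have hps₀ : 0 ≤ Real.sin p₀.2.2 :=
    ge_of_tendsto' ((hsin.tendsto p₀).comp hlp) fun n => hps (ψ n)
  have hqs₀ : Real.sin q₀.2.2 ≤ 0 :=
    le_of_tendsto' ((hsin.tendsto q₀).comp hlq) fun n => hqs (ψ n)
  have hcont : Continuous fun p => toNullGeodesic (nullVector hr hpos ha p) :=
    continuous_quot_mk.comp (continuous_nullVector hr hpos ha)
  refine ⟨fun n => toNullGeodesic (nullVector hr hpos ha (p (ψ n))), _, _,
    (hcont.tendsto p₀).comp hlp, ?_, toNullGeodesic_nullVector_ne hr hpos ha hpc₀ hqc₀ hps₀ hqs₀,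
    isOverMeridian_nullVector hr hpos ha hpc₀, isOverMeridian_nullVector hr hpos ha hqc₀⟩
  simp only [hpq]
  exact (hcont.tendsto q₀).comp hlq

end NullGeod

end

theorem proposition4p3_general (r : ℝ → ℝ) (hr : ContDiff ℝ 2 r)
    (hpos : ∀ x ∈ Ioo (0 : ℝ) 1, 0 < r x) (h1 : r 1 = 0) :
    ¬ T2Space (NullGeod.NullGeodesicSpace r) ∧
    ∃ (κ : ℕ → NullGeod.NullGeodesicSpace r) (κ₁ κ₂ : NullGeod.NullGeodesicSpace r),
      Tendsto κ atTop (𝓝 κ₁) ∧ Tendsto κ atTop (𝓝 κ₂) ∧ κ₁ ≠ κ₂ ∧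
      NullGeod.IsOverMeridian κ₁ ∧ NullGeod.IsOverMeridian κ₂ := by
  have h := NullGeod.exists_tendsto_two_limits hr hpos h1
  refine ⟨fun hT2 => ?_, h⟩
  obtain ⟨κ, κ₁, κ₂, hκ₁, hκ₂, hne, -⟩ := h
  exact hne (tendsto_nhds_unique hκ₁ hκ₂)

theorem proposition4p3 (r : ℝ → ℝ) (hr : ContDiff ℝ ∞ r)
    (hpos : ∀ x ∈ Ioo (0 : ℝ) 1, 0 < r x) (h0 : r 0 = 0) (h1 : r 1 = 0)
    (hd0 : |deriv r 0| < 1 / (2 * Real.pi)) (hd1 : |deriv r 1| < 1 / (2 * Real.pi)) :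
    ¬ T2Space (NullGeod.NullGeodesicSpace r) ∧
    ∃ (κ : ℕ → NullGeod.NullGeodesicSpace r) (κ₁ κ₂ : NullGeod.NullGeodesicSpace r),
      Tendsto κ atTop (𝓝 κ₁) ∧ Tendsto κ atTop (𝓝 κ₂) ∧ κ₁ ≠ κ₂ ∧
      NullGeod.IsOverMeridian κ₁ ∧ NullGeod.IsOverMeridian κ₂ :=
  proposition4p3_general r (contDiff_infty.1 hr 2) hpos h1
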